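/- Let $\mathbb{N}=\{1,2,3,\dots\}$, let $\mathcal{P}$ be the set of primes, and let $f:\mathbb{N}^2\to\mathbb{C}$ be multiplicative, i.e. $f(m_1n_1,m_2n_2)=f(m_1,m_2)f(n_1,n_2)$ whenever $\gcd(m_1m_2,n_1n_2)=1$. Let $k\in\mathbb{N}$. (i) Suppose $$\sum_{p\in\mathcal{P}}\Bigl(\frac{|f(p,1)-k|+|f(1,p)-k|}{p}+\sum_{\substack{\nu_1,\nu_2\ge 0\\ \nu_1+\nu_2\ge 2}}\frac{|f(p^{\nu_1},p^{\nu_2})|}{p^{\nu_1+\nu_2}}\Bigr)<\infty .$$ Then $$\lim_{x,y\to\infty}\frac{1}{xy(\log x\log y)^{k-1}}\sum_{n_1\le x,\ n_2\le y}f(n_1,n_2)=\frac{1}{((k-1)!)^2}\prod_{p\in\mathcal{P}}\Bigl(1-\frac1p\Bigr)^{2k}\Bigl(\sum_{\nu_1,\nu_2\ge 0}\frac{f(p^{\nu_1},p^{\nu_2})}{p^{\nu_1+\nu_2}}\Bigr),$$ where $x$ and $y$ tend to infinity independently. (ii) Suppose $$\sum_{p\in\mathcal{P}}\Bigl(\frac{|f(p,1)-k|+|f(1,p)-k|}{p}+\frac{|f(p,p)-p|}{p^2}+\sum_{\substack{\nu_1,\nu_2\ge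 0,\ \nu_1+\nu_2\ge 2\\ (\nu_1,\nu_2)\ne(1,1)}}\frac{|f(p^{\nu_1},p^{\nu_2})|}{p^{\nu_1+\nu_2}}\Bigr)<\infty .$$ Then $$\lim_{x\to\infty}\frac{1}{x^2(\log x)^{2k-1}}\sum_{n_1,n_2\le x}f(n_1,n_2)=\frac{1}{((k-1)!)^2(2k-1)}\prod_{p\in\mathcal{P}}\Bigl(1-\frac1p\Bigr)^{2k+1}\Bigl(\sum_{\nu_1,\nu_2\ge 0}\frac{f(p^{\nu_1},p^{\nu_2})}{p^{\nu_1+\nu_2}}\Bigr).$$ In both parts the series over $\nu_1,\nu_2$ converge absolutely and the product over the primes converges unconditionally. -/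

import Mathlib

open Filter Topology
open scoped Nat

noncomputable section

/-- An arithmetic function of two variables is a map on pairs of positive integers; it is
represented by `f : ℕ → ℕ → ℂ`, whose values with an argument `0` are never used.
It is multiplicative if `f (m₁ n₁, m₂ n₂) = f (m₁, m₂) f (n₁, n₂)` for all positive integers with
`gcd (m₁ m₂, n₁ n₂) = 1`. -/
def IsMultiplicativeTwo (f : ℕ → ℕ → ℂ) : Prop :=
  ∀ m₁ m₂ n₁ n₂ : ℕ, 0 < m₁ → 0 < m₂ → 0 < n₁ → 0 < n₂ →
    Nat.gcd (m₁ * m₂) (n₁ * n₂) = 1 →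
      f (m₁ * n₁) (m₂ * n₂) = f m₁ m₂ * f n₁ n₂

/-- The sum of `f (n₁, n₂)` over positive integers `n₁ ≤ x`, `n₂ ≤ y`. -/
def sumUpTo (f : ℕ → ℕ → ℂ) (x y : ℝ) : ℂ :=
  ∑ n₁ ∈ Finset.Icc 1 ⌊x⌋₊, ∑ n₂ ∈ Finset.Icc 1 ⌊y⌋₊, f n₁ n₂

/-- The term `f (p ^ ν₁, p ^ ν₂) / p ^ (ν₁ + ν₂)`, where `ν = (ν₁, ν₂)`. -/
def localTerm (f : ℕ → ℕ → ℂ) (p : ℕ) (ν : ℕ × ℕ) : ℂ :=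
  f (p ^ ν.1) (p ^ ν.2) / (p : ℂ) ^ (ν.1 + ν.2)

/-- The factor `(1 - 1 / p) ^ e * ∑_{ν₁, ν₂ ≥ 0} f (p ^ ν₁, p ^ ν₂) / p ^ (ν₁ + ν₂)`. -/
def eulerFactor (f : ℕ → ℕ → ℂ) (e : ℕ) (p : ℕ) : ℂ :=
  (1 - 1 / (p : ℂ)) ^ e * ∑' ν : ℕ × ℕ, localTerm f p ν

/-- Finiteness of
`∑_p ((|f (p, 1) - k| + |f (1, p) - k|) / p + ∑_{ν₁ + ν₂ ≥ 2} |f (p ^ ν₁, p ^ ν₂)| / p ^ (ν₁ + ν₂))`: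
every inner series converges and so does the series over the primes. -/
def ConditionOne (f : ℕ → ℕ → ℂ) (k : ℕ) : Prop :=
  (∀ p : Nat.Primes, Summable
    fun ν : {ν : ℕ × ℕ // 2 ≤ ν.1 + ν.2} => ‖localTerm f p ν.1‖) ∧
  Summable fun p : Nat.Primes =>
    (‖f p 1 - k‖ + ‖f 1 p - k‖) / (p : ℝ)
      + ∑' ν : {ν : ℕ × ℕ // 2 ≤ ν.1 + ν.2}, ‖localTerm f p ν.1‖

/-- The same condition, with the pair `(ν₁, ν₂) = (1, 1)` taken out of the inner series and
replaced by the separate term `|f (p, p) - p| / p ^ 2`. -/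
def ConditionTwo (f : ℕ → ℕ → ℂ) (k : ℕ) : Prop :=
  (∀ p : Nat.Primes, Summable
    fun ν : {ν : ℕ × ℕ // 2 ≤ ν.1 + ν.2 ∧ ν ≠ (1, 1)} => ‖localTerm f p ν.1‖) ∧
  Summable fun p : Nat.Primes =>
    (‖f p 1 - k‖ + ‖f 1 p - k‖) / (p : ℝ) + ‖f p p - (p : ℂ)‖ / (p : ℝ) ^ 2
      + ∑' ν : {ν : ℕ × ℕ // 2 ≤ ν.1 + ν.2 ∧ ν ≠ (1, 1)}, ‖localTerm f p ν.1‖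

end

/-! Put `h = μ^k * μ^k * f`, the power `μ^k` being convolved once in each variable. This multiplies
the local series `∑ f(p^ν₁, p^ν₂) z₁^ν₁ z₂^ν₂ / p^(ν₁+ν₂)` by `(1 - z₁/p)^k (1 - z₂/p)^k`, which
cancels the terms `k/p` at `(1, 0)` and `(0, 1)`. What is left besides the constant term `1` is
absolutely summable over all primes and exponents (`LocallyNear.shift`), so `∑ |h(a, b)|/(ab)`
converges and has an Euler product (`summable_and_hasProd_of_multiplicative`), whose factors are
those in part (i).

Conversely `f = ζ^k * ζ^k * h`, so the sum of `f` is `xy ∑ h(a, b)/(ab) D(x/a) D(y/b)`, where `D(x)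
∼ (log x)^(k-1)/(k-1)!` is the mean of the `k`-fold divisor function. Dominated convergence gives
part (i) (`LocallyNear.multipliable_and_tendsto`).

In part (ii) the local term at `(1, 1)` is also close to `1/p`. Convolving along the diagonal with
`n ↦ n μ(n)` multiplies the local series by `1 - z₁z₂/p`, cancels that term and gives a function `g`
to which the argument for part (i) applies. Then `f` is the diagonal convolution of `g` with `n ↦
n`, so the normalised sum of `f` at `x` is `∑_{m ≤ x} G(x/m)/m`, where `G(x)` is the normalised sum
of `g` over the square and is asymptotic to a constant times `(log x)^(2k-2)`. Such a summation adds
one logarithm and divides the constant by `2k - 1` (`LogAsymptotic.sum_div`). -/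

/-! ### Convolutions in one variable and along the diagonal -/

/-- The function `n ↦ f (n, n₂)` as an arithmetic function. -/
def sectionAt (f : ℕ → ℕ → ℂ) (n₂ : ℕ) : ArithmeticFunction ℂ :=
  ⟨fun n => if n = 0 then 0 else f n n₂, by simp⟩

lemma sectionAt_apply (f : ℕ → ℕ → ℂ) (n₂ : ℕ) {n : ℕ} (hn : n ≠ 0) :
    sectionAt f n₂ n = f n n₂ := by
  simp [sectionAt, hn]

/-- Dirichlet convolution of `c` with `f` in the first variable. -/
def convFst (c : ArithmeticFunction ℂ) (f : ℕ → ℕ → ℂ) (n₁ n₂ : ℕ) : ℂ :=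
  (c * sectionAt f n₂) n₁

/-- Dirichlet convolution of `c` with `f` in the second variable. -/
def convSnd (c : ArithmeticFunction ℂ) (f : ℕ → ℕ → ℂ) (n₁ n₂ : ℕ) : ℂ :=
  convFst c (fun a b => f b a) n₂ n₁

/-- Dirichlet convolution of `c` with `f` along the diagonal. -/
def convDiag (c : ArithmeticFunction ℂ) (f : ℕ → ℕ → ℂ) (n₁ n₂ : ℕ) : ℂ :=
  ∑ x ∈ (Nat.gcd n₁ n₂).divisorsAntidiagonal, c x.1 * f (n₁ / x.1) (n₂ / x.1)

lemma sectionAt_convFst (c : ArithmeticFunction ℂ) (f : ℕ → ℕ → ℂ) (n₂ : ℕ) :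
    sectionAt (convFst c f) n₂ = c * sectionAt f n₂ := by
  ext n
  rcases eq_or_ne n 0 with rfl | hn
  · simp
  · rw [sectionAt_apply _ _ hn, convFst]

lemma convFst_convFst (c d : ArithmeticFunction ℂ) (f : ℕ → ℕ → ℂ) :
    convFst c (convFst d f) = convFst (c * d) f := by
  ext n₁ n₂
  change (c * sectionAt (convFst d f) n₂) n₁ = _
  rw [sectionAt_convFst, ← mul_assoc]
  rfl

lemma convFst_one (f : ℕ → ℕ → ℂ) {n₁ : ℕ} (n₂ : ℕ) (hn : n₁ ≠ 0) : convFst 1 f n₁ n₂ = f n₁ n₂ := by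
  rw [convFst, one_mul, sectionAt_apply _ _ hn]

lemma convFst_eq_sum (c : ArithmeticFunction ℂ) (f : ℕ → ℕ → ℂ) (n₁ n₂ : ℕ) :
    convFst c f n₁ n₂ = ∑ x ∈ n₁.divisorsAntidiagonal, c x.1 * f x.2 n₂ := by
  rw [convFst, ArithmeticFunction.mul_apply]
  refine Finset.sum_congr rfl fun x hx => ?_
  rw [sectionAt_apply _ _ (Nat.right_ne_zero_of_mem_divisorsAntidiagonal hx)]

lemma sum_divisorsAntidiagonal_mul {R : Type*} [AddCommMonoid R] {m n : ℕ} (h : m.Coprime n)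
    (F : ℕ × ℕ → R) :
    ∑ x ∈ (m * n).divisorsAntidiagonal, F x =
      ∑ x ∈ m.divisorsAntidiagonal, ∑ y ∈ n.divisorsAntidiagonal, F (x.1 * y.1, x.2 * y.2) := by
  rw [← Finset.sum_product']
  symm
  have key : ∀ {a b c d : ℕ}, a * b = m → c * d = n → a.Coprime c ∧ a.Coprime d ∧ b.Coprime c ∧
      b.Coprime d := by
    rintro a b c d rfl rfl
    simpa [Nat.coprime_mul_iff_left, Nat.coprime_mul_iff_right, and_assoc, and_comm,
      and_left_comm] using h
  apply Finset.sum_nbij fun x : (ℕ × ℕ) × (ℕ × ℕ) => (x.1.1 * x.2.1, x.1.2 * x.2.2)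
  · rintro ⟨⟨a1, a2⟩, ⟨b1, b2⟩⟩ hx
    simp only [Nat.mem_divisorsAntidiagonal, Ne, Finset.mem_product] at hx ⊢
    obtain ⟨⟨rfl, ha⟩, ⟨rfl, hb⟩⟩ := hx
    exact ⟨by ring, mul_ne_zero ha hb⟩
  · rintro ⟨⟨a1, a2⟩, ⟨b1, b2⟩⟩ h1 ⟨⟨c1, c2⟩, ⟨d1, d2⟩⟩ h2 he
    simp only [Nat.mem_divisorsAntidiagonal, Ne, Finset.mem_product, Finset.mem_coe,
      Prod.mk.injEq] at h1 h2 he ⊢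
    obtain ⟨⟨e1, n1⟩, ⟨e2, n2⟩⟩ := h1
    obtain ⟨⟨e3, -⟩, ⟨e4, -⟩⟩ := h2
    have key' : ∀ {a b c d : ℕ}, a.Coprime d → c.Coprime b → a * b = c * d → a = c := by
      intro a b c d h3 h4 h5
      exact Nat.dvd_antisymm (h3.dvd_of_dvd_mul_right (h5 ▸ dvd_mul_right a b))
        (h4.dvd_of_dvd_mul_right (h5 ▸ dvd_mul_right c d))
    have c1 := key e1 e4
    have c2 := key e3 e2
    have c3 := he.1
    have c4 := he.2
    refine ⟨⟨key' c1.1 c2.1 c3, key' c1.2.2.2 c2.2.2.2 c4⟩, ?_, ?_⟩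
    · exact key' c2.1.symm c1.1.symm (by rw [mul_comm, c3, mul_comm])
    · exact key' c2.2.2.2.symm c1.2.2.2.symm (by rw [mul_comm, c4, mul_comm])
  · rintro ⟨b1, b2⟩ hx
    simp only [Nat.mem_divisorsAntidiagonal, Ne, Finset.mem_coe, mul_eq_zero, not_or] at hx
    simp only [Set.mem_image, Finset.coe_product, Set.mem_prod, Finset.mem_coe,
      Nat.mem_divisorsAntidiagonal, Prod.exists, Prod.mk.injEq]
    -- Coprimality makes the factorisation unique: the part of each divisor coming from `m` is its
    -- gcd with `m`, and likewise for `n`.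
    refine ⟨b1.gcd m, b2.gcd m, b1.gcd n, b2.gcd n, ⟨⟨?_, hx.2.1⟩, ⟨?_, hx.2.2⟩⟩, ?_, ?_⟩
    · exact Nat.gcd_mul_gcd_of_coprime_of_mul_eq_mul h hx.1
    · exact Nat.gcd_mul_gcd_of_coprime_of_mul_eq_mul h.symm (by rw [hx.1, mul_comm])
    · rw [← h.gcd_mul, Nat.gcd_eq_left (hx.1 ▸ dvd_mul_right _ _)]
    · rw [← h.gcd_mul, Nat.gcd_eq_left (hx.1 ▸ dvd_mul_left _ _)]
  · simp

lemma IsMultiplicativeTwo.swap {f : ℕ → ℕ → ℂ} (hf : IsMultiplicativeTwo f) :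
    IsMultiplicativeTwo fun a b => f b a := fun m₁ m₂ n₁ n₂ h1 h2 h3 h4 h =>
  hf m₂ m₁ n₂ n₁ h2 h1 h4 h3 (by rwa [mul_comm m₂, mul_comm n₂])

lemma IsMultiplicativeTwo.convFst {f : ℕ → ℕ → ℂ} (hf : IsMultiplicativeTwo f)
    {c : ArithmeticFunction ℂ} (hc : c.IsMultiplicative) : IsMultiplicativeTwo (convFst c f) := by
  intro m₁ m₂ n₁ n₂ h1 h2 h3 h4 h
  have hmn : Nat.Coprime m₁ n₁ := Nat.Coprime.coprime_mul_right (Nat.Coprime.coprime_mul_right_right h)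
  simp only [convFst_eq_sum]
  rw [sum_divisorsAntidiagonal_mul hmn, Finset.sum_mul_sum]
  refine Finset.sum_congr rfl fun x hx => Finset.sum_congr rfl fun y hy => ?_
  simp only [Nat.mem_divisorsAntidiagonal] at hx hy
  obtain ⟨rfl, hx0⟩ := hx
  obtain ⟨rfl, hy0⟩ := hy
  have hxy : Nat.Coprime (x.2 * m₂) (y.2 * n₂) :=
    Nat.Coprime.coprime_dvd_left (mul_dvd_mul_right (dvd_mul_left _ _) _)
      (Nat.Coprime.coprime_dvd_right (mul_dvd_mul_right (dvd_mul_left _ _) _) h)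
  dsimp only
  rw [hc.map_mul_of_coprime (Nat.Coprime.coprime_dvd_left (dvd_mul_right _ _)
      (Nat.Coprime.coprime_dvd_right (dvd_mul_right _ _) hmn)),
    hf _ _ _ _ (Nat.pos_of_ne_zero (right_ne_zero_of_mul hx0)) h2
      (Nat.pos_of_ne_zero (right_ne_zero_of_mul hy0)) h4 hxy]
  ring

lemma IsMultiplicativeTwo.convSnd {f : ℕ → ℕ → ℂ} (hf : IsMultiplicativeTwo f)
    {c : ArithmeticFunction ℂ} (hc : c.IsMultiplicative) : IsMultiplicativeTwo (convSnd c f) :=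
  (hf.swap.convFst hc).swap

lemma IsMultiplicativeTwo.convDiag {f : ℕ → ℕ → ℂ} (hf : IsMultiplicativeTwo f)
    {c : ArithmeticFunction ℂ} (hc : c.IsMultiplicative) : IsMultiplicativeTwo (convDiag c f) := by
  intro m₁ m₂ n₁ n₂ h1 h2 h3 h4 h
  have h' : Nat.Coprime (m₁ * m₂) (n₁ * n₂) := h
  have hc1 : Nat.Coprime m₁ n₁ := h'.coprime_mul_right.coprime_mul_right_right
  have hc2 : Nat.Coprime m₂ n₁ := h'.coprime_mul_left.coprime_mul_right_right
  have hc3 : Nat.Coprime m₁ n₂ := h'.coprime_mul_right.coprime_mul_left_right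
  have hc4 : Nat.Coprime m₂ n₂ := h'.coprime_mul_left.coprime_mul_left_right
  -- All cross gcds are `1`, so the gcd splits, and with it the range of the diagonal sum.
  have hg : Nat.gcd (m₁ * n₁) (m₂ * n₂) = Nat.gcd m₁ m₂ * Nat.gcd n₁ n₂ := by
    rw [hc4.gcd_mul, hc2.symm.gcd_mul_right_cancel, hc3.gcd_mul_left_cancel]
  have hgg : Nat.Coprime (Nat.gcd m₁ m₂) (Nat.gcd n₁ n₂) :=
    Nat.Coprime.coprime_dvd_left (Nat.gcd_dvd_left _ _)
      (Nat.Coprime.coprime_dvd_right (Nat.gcd_dvd_left _ _) hc1)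
  simp only [_root_.convDiag]
  rw [hg, sum_divisorsAntidiagonal_mul hgg, Finset.sum_mul_sum]
  refine Finset.sum_congr rfl fun x hx => Finset.sum_congr rfl fun y hy => ?_
  have hx1 : x.1 ∣ Nat.gcd m₁ m₂ := Nat.dvd_of_mem_divisors (Nat.fst_mem_divisors_of_mem_antidiagonal hx)
  have hy1 : y.1 ∣ Nat.gcd n₁ n₂ := Nat.dvd_of_mem_divisors (Nat.fst_mem_divisors_of_mem_antidiagonal hy)
  have d1 := hx1.trans (Nat.gcd_dvd_left _ _)
  have d2 := hx1.trans (Nat.gcd_dvd_right _ _)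
  have d3 := hy1.trans (Nat.gcd_dvd_left _ _)
  have d4 := hy1.trans (Nat.gcd_dvd_right _ _)
  dsimp only
  rw [hc.map_mul_of_coprime (Nat.Coprime.coprime_dvd_left hx1 (Nat.Coprime.coprime_dvd_right hy1 hgg)),
    ← Nat.div_mul_div_comm d1 d3, ← Nat.div_mul_div_comm d2 d4,
    hf _ _ _ _ (Nat.pos_of_dvd_of_pos (Nat.div_dvd_of_dvd d1) h1)
      (Nat.pos_of_dvd_of_pos (Nat.div_dvd_of_dvd d2) h2)
      (Nat.pos_of_dvd_of_pos (Nat.div_dvd_of_dvd d3) h3)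
      (Nat.pos_of_dvd_of_pos (Nat.div_dvd_of_dvd d4) h4)
      (Nat.Coprime.coprime_dvd_left (mul_dvd_mul (Nat.div_dvd_of_dvd d1) (Nat.div_dvd_of_dvd d2))
        (Nat.Coprime.coprime_dvd_right (mul_dvd_mul (Nat.div_dvd_of_dvd d3) (Nat.div_dvd_of_dvd d4)) h'))]
  ring

/-- The arithmetic function `n ↦ n`. -/
def idFun : ArithmeticFunction ℂ := ⟨fun n => n, by simp⟩

/-- The arithmetic function `n ↦ n μ(n)`, the Dirichlet inverse of `n ↦ n`. -/
def idMoebius : ArithmeticFunction ℂ := ⟨fun n => n * (ArithmeticFunction.moebius n : ℂ), by simp⟩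

lemma idMoebius_isMultiplicative : idMoebius.IsMultiplicative := by
  refine ⟨by simp [idMoebius], fun {m n} h => ?_⟩
  simp only [idMoebius, ArithmeticFunction.coe_mk]
  rw [ArithmeticFunction.isMultiplicative_moebius.map_mul_of_coprime h]
  push_cast
  ring

lemma idFun_mul_idMoebius : idFun * idMoebius = 1 := by
  ext n
  rw [ArithmeticFunction.mul_apply]
  have h : ∀ x ∈ n.divisorsAntidiagonal, idFun x.1 * idMoebius x.2 =
      n * ((ArithmeticFunction.zeta : ArithmeticFunction ℂ) x.1 *
        (ArithmeticFunction.moebius : ArithmeticFunction ℂ) x.2) := by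
    intro x hx
    have := Nat.left_ne_zero_of_mem_divisorsAntidiagonal hx
    rw [Nat.mem_divisorsAntidiagonal] at hx
    rw [← hx.1]
    simp [idFun, idMoebius, ArithmeticFunction.natCoe_apply, this]
    ring
  rw [Finset.sum_congr rfl h, ← Finset.mul_sum, ← ArithmeticFunction.mul_apply,
    ArithmeticFunction.coe_zeta_mul_coe_moebius, ArithmeticFunction.one_apply]
  split_ifs with h1 <;> simp [h1]

/-- Along a ray `e ↦ (e a, e b)` with `a`, `b` coprime, the gcd is exactly `e`, so diagonal
convolution is ordinary Dirichlet convolution in `e`. Associativity and Möbius inversion carry over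
this way; the second argument `1` is a dummy. -/
lemma convDiag_mul_mul (c : ArithmeticFunction ℂ) (f : ℕ → ℕ → ℂ) {a b e : ℕ} (hab : a.Coprime b) :
    convDiag c f (e * a) (e * b) = convFst c (fun m _ => f (m * a) (m * b)) e 1 := by
  rw [convDiag, convFst_eq_sum, Nat.gcd_mul_left, hab.gcd_eq_one, mul_one]
  refine Finset.sum_congr rfl fun x hx => ?_
  have h1 := Nat.pos_of_ne_zero (Nat.left_ne_zero_of_mem_divisorsAntidiagonal hx)
  rw [Nat.mem_divisorsAntidiagonal] at hx
  rw [← hx.1, mul_assoc, mul_assoc, Nat.mul_div_cancel_left _ h1, Nat.mul_div_cancel_left _ h1]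

lemma convDiag_idFun_idMoebius (f : ℕ → ℕ → ℂ) {n₁ n₂ : ℕ} (h1 : n₁ ≠ 0) (h2 : n₂ ≠ 0) :
    convDiag idFun (convDiag idMoebius f) n₁ n₂ = f n₁ n₂ := by
  obtain ⟨a, b, hab, ha, hb⟩ := Nat.exists_coprime n₁ n₂
  have hg : Nat.gcd n₁ n₂ ≠ 0 := Nat.gcd_ne_zero_left h1
  rw [mul_comm] at ha hb
  generalize Nat.gcd n₁ n₂ = g at *
  subst ha hb
  rw [convDiag_mul_mul _ _ hab]
  trans convFst idFun (convFst idMoebius fun m _ => f (m * a) (m * b)) g 1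
  · rw [convFst_eq_sum, convFst_eq_sum]
    refine Finset.sum_congr rfl fun x hx => ?_
    rw [convDiag_mul_mul _ _ hab]
  · rw [convFst_convFst, idFun_mul_idMoebius, convFst_one _ _ hg]

/-! ### Summatory functions of convolutions -/

lemma sum_convFst (c : ArithmeticFunction ℂ) (f : ℕ → ℕ → ℂ) (N n₂ : ℕ) :
    ∑ n ∈ Finset.Ioc 0 N, convFst c f n n₂ =
      ∑ d ∈ Finset.Ioc 0 N, f d n₂ * ∑ e ∈ Finset.Ioc 0 (N / d), c e := by
  simp only [convFst]
  rw [mul_comm c, ArithmeticFunction.sum_Ioc_mul_eq_sum_sum]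
  refine Finset.sum_congr rfl fun d hd => ?_
  rw [sectionAt_apply _ _ (Finset.mem_Ioc.1 hd).1.ne']

lemma sum_sum_convFst_convSnd (c : ArithmeticFunction ℂ) (f : ℕ → ℕ → ℂ) (N M : ℕ) :
    ∑ n₁ ∈ Finset.Ioc 0 N, ∑ n₂ ∈ Finset.Ioc 0 M, convSnd c (convFst c f) n₁ n₂ =
      ∑ d₁ ∈ Finset.Ioc 0 N, ∑ d₂ ∈ Finset.Ioc 0 M, f d₁ d₂ *
        ((∑ e ∈ Finset.Ioc 0 (N / d₁), c e) * ∑ e ∈ Finset.Ioc 0 (M / d₂), c e) := by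
  simp only [convSnd, sum_convFst]
  rw [Finset.sum_comm]
  simp only [← Finset.sum_mul, sum_convFst]
  rw [Finset.sum_congr rfl fun _ _ => Finset.sum_mul _ _ _, Finset.sum_comm]
  simp only [mul_assoc]

lemma sum_Ioc_dvd {R : Type*} [AddCommMonoid R] (N : ℕ) {d : ℕ} (hd : 0 < d) (F : ℕ → R) :
    ∑ n ∈ Finset.Ioc 0 N with d ∣ n, F (n / d) = ∑ e ∈ Finset.Ioc 0 (N / d), F e := by
  refine Finset.sum_nbij' (fun n => n / d) (fun e => d * e) ?_ ?_ ?_ ?_ ?_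
  · intro n hn
    simp only [Finset.mem_filter, Finset.mem_Ioc] at hn ⊢
    exact ⟨Nat.pos_of_dvd_of_pos (Nat.div_dvd_of_dvd hn.2) hn.1.1, Nat.div_le_div_right hn.1.2⟩
  · intro e he
    simp only [Finset.mem_filter, Finset.mem_Ioc] at he ⊢
    exact ⟨⟨Nat.mul_pos hd he.1, (Nat.mul_le_mul_left d he.2).trans (Nat.mul_div_le N d)⟩,
      dvd_mul_right _ _⟩
  · intro n hn
    exact Nat.mul_div_cancel' (Finset.mem_filter.1 hn).2
  · intro e _
    exact Nat.mul_div_cancel_left e hd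
  · simp

lemma sum_sum_convDiag (c : ArithmeticFunction ℂ) (f : ℕ → ℕ → ℂ) (N : ℕ) :
    ∑ n₁ ∈ Finset.Ioc 0 N, ∑ n₂ ∈ Finset.Ioc 0 N, convDiag c f n₁ n₂ =
      ∑ d ∈ Finset.Ioc 0 N, c d *
        ∑ n₁ ∈ Finset.Ioc 0 (N / d), ∑ n₂ ∈ Finset.Ioc 0 (N / d), f n₁ n₂ := by
  -- The divisors of the gcd are the common divisors; letting `d` run over a range independent of
  -- `n₁` and `n₂` allows the sums to be exchanged.
  have h : ∀ n₁ ∈ Finset.Ioc 0 N, ∀ n₂ ∈ Finset.Ioc 0 N, convDiag c f n₁ n₂ =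
      ∑ d ∈ Finset.Ioc 0 N, if d ∣ n₁ then if d ∣ n₂ then c d * f (n₁ / d) (n₂ / d) else 0 else 0 := by
    intro n₁ h1 n₂ h2
    rw [Finset.mem_Ioc] at h1 h2
    simp only [← ite_and, ← Finset.sum_filter, convDiag]
    rw [Nat.sum_divisorsAntidiagonal (fun d _ => c d * f (n₁ / d) (n₂ / d))]
    refine Finset.sum_congr ?_ fun _ _ => rfl
    ext d
    simp only [Nat.mem_divisors, Finset.mem_filter, Finset.mem_Ioc, Nat.dvd_gcd_iff]
    constructor
    · rintro ⟨hd, -⟩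
      exact ⟨⟨Nat.pos_of_dvd_of_pos hd.1 h1.1, (Nat.le_of_dvd h1.1 hd.1).trans h1.2⟩, hd⟩
    · rintro ⟨-, hd⟩
      exact ⟨hd, Nat.gcd_ne_zero_left h1.1.ne'⟩
  rw [Finset.sum_congr rfl fun n₁ h1 => Finset.sum_congr rfl (h n₁ h1)]
  rw [Finset.sum_congr rfl fun n₁ _ => Finset.sum_comm, Finset.sum_comm]
  refine Finset.sum_congr rfl fun d hd => ?_
  have hd := (Finset.mem_Ioc.1 hd).1
  simp only [Finset.mul_sum]
  rw [← sum_Ioc_dvd N hd, Finset.sum_filter]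
  refine Finset.sum_congr rfl fun n₁ _ => ?_
  split_ifs with h1
  · rw [← sum_Ioc_dvd N hd, Finset.sum_filter]
  · simp

/-! ### Local series and their multiplication by `1 - z ^ u / p` -/

/-- The local terms of `f` are summable over all primes and exponents after subtraction of
`1` at `ν = 0` and of `A ν / p`. -/
def LocallyNear (f : ℕ → ℕ → ℂ) (A : ℕ × ℕ → ℂ) : Prop :=
  Summable fun q : Nat.Primes × (ℕ × ℕ) =>
    localTerm f q.1 q.2 - (if q.2 = 0 then 1 else 0) - A q.2 / ((q.1 : ℕ) : ℂ)

/-- `g` arises from `f` by multiplying each local series by `1 - z ^ u / p`. -/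
def IsLocalShift (u : ℕ × ℕ) (f g : ℕ → ℕ → ℂ) : Prop :=
  ∀ (p : Nat.Primes) (ν : ℕ × ℕ), localTerm g p ν =
    localTerm f p ν - if u ≤ ν then 1 / ((p : ℕ) : ℂ) * localTerm f p (ν - u) else 0

lemma le_of_notMem_range_add_right {u ν : ℕ × ℕ} (h : ν ∉ Set.range fun x => x + u) : ¬ u ≤ ν :=
  fun h' => h ⟨ν - u, tsub_add_cancel_of_le h'⟩

lemma summable_shift {G : ℕ × ℕ → ℂ} (hG : Summable G) (u : ℕ × ℕ) :
    Summable (fun ν => if u ≤ ν then G (ν - u) else 0) := by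
  refine ((add_left_injective u).summable_iff fun ν hν => ?_).1 ?_
  · exact if_neg (le_of_notMem_range_add_right hν)
  · simpa [Function.comp_def] using hG

lemma tsum_shift (G : ℕ × ℕ → ℂ) (u : ℕ × ℕ) :
    ∑' ν, (if u ≤ ν then G (ν - u) else 0) = ∑' ν, G ν := by
  rw [← (add_left_injective u).tsum_eq]
  · simp
  · intro ν hν
    by_contra h
    exact hν (if_neg (le_of_notMem_range_add_right h))

lemma summable_prod_shift {ι : Type*} {G : ι × (ℕ × ℕ) → ℂ} (hG : Summable G) (u : ℕ × ℕ) :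
    Summable (fun q : ι × (ℕ × ℕ) => if u ≤ q.2 then G (q.1, q.2 - u) else 0) := by
  have hinj : Function.Injective fun q : ι × (ℕ × ℕ) => (q.1, q.2 + u) := by
    rintro ⟨a, b⟩ ⟨c, d⟩ h
    simpa using h
  refine (hinj.summable_iff fun q hq => ?_).1 ?_
  · refine if_neg fun h => hq ⟨(q.1, q.2 - u), ?_⟩
    simp [tsub_add_cancel_of_le h]
  · simpa [Function.comp_def] using hG

lemma summable_primes_one_div_sq :
    Summable fun p : Nat.Primes => 1 / ((p : ℕ) : ℂ) ^ 2 := by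
  have h : Summable fun n : ℕ => 1 / (n : ℂ) ^ 2 := by
    have := (Complex.ofRealCLM.summable (Real.summable_one_div_nat_pow.2 one_lt_two))
    simpa using this
  exact h.comp_injective Subtype.val_injective

lemma norm_one_div_prime_le (p : Nat.Primes) : ‖1 / ((p : ℕ) : ℂ)‖ ≤ 1 := by
  rw [norm_div, norm_one, Complex.norm_natCast]
  exact div_le_one_of_le₀ (by exact_mod_cast p.2.one_le) (by positivity)

lemma LocallyNear.summable_localTerm {f : ℕ → ℕ → ℂ} {A : ℕ × ℕ → ℂ} (h : LocallyNear f A)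
    (hA : Summable A) (p : Nat.Primes) : Summable fun ν : ℕ × ℕ => localTerm f p ν := by
  have h1 : Summable fun ν : ℕ × ℕ => localTerm f p ν - (if ν = 0 then 1 else 0) -
      A ν / ((p : ℕ) : ℂ) := Summable.prod_factor h p
  have h2 : Summable fun ν : ℕ × ℕ => (if ν = 0 then 1 else 0 : ℂ) :=
    summable_of_ne_finset_zero (s := {0}) fun ν hν => if_neg (by simpa using hν)
  have h3 := (h1.add h2).add (hA.div_const (((p : ℕ) : ℂ)))
  refine h3.congr fun ν => ?_
  ring

/-- The subtracted term is `1/p` times the local term at `ν - u`, which has three pieces: the `1` at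
exponent `0` gives `1/p` at `u`, the piece `A/p` gives `A/p²`, which is summable over primes and
exponents, and the remainder stays summable after division by `p`. -/
lemma LocallyNear.shift {f g : ℕ → ℕ → ℂ} {A : ℕ × ℕ → ℂ} {u : ℕ × ℕ} (h : LocallyNear f A)
    (hA : Summable A) (hg : IsLocalShift u f g) :
    LocallyNear g fun ν => A ν - if ν = u then 1 else 0 := by
  have hAp : Summable fun q : Nat.Primes × (ℕ × ℕ) => 1 / ((q.1 : ℕ) : ℂ) ^ 2 * A q.2 :=
    summable_mul_of_summable_norm (f := fun p : Nat.Primes => 1 / ((p : ℕ) : ℂ) ^ 2) (g := A)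
      summable_primes_one_div_sq.norm hA.norm
  have h1 : Summable fun q : Nat.Primes × (ℕ × ℕ) => 1 / ((q.1 : ℕ) : ℂ) *
      (localTerm f q.1 q.2 - (if q.2 = 0 then 1 else 0) - A q.2 / ((q.1 : ℕ) : ℂ)) := by
    refine Summable.of_norm_bounded h.norm fun q => ?_
    rw [norm_mul]
    exact mul_le_of_le_one_left (norm_nonneg _) (norm_one_div_prime_le _)
  refine ((h.sub (summable_prod_shift h1 u)).sub (summable_prod_shift hAp u)).congr fun q => ?_
  obtain ⟨p, ν⟩ := q
  simp only [hg p ν]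
  by_cases hu : u ≤ ν
  · have h0 : ν - u = 0 ↔ ν = u := by
      rw [tsub_eq_zero_iff_le]
      exact ⟨fun h => le_antisymm h hu, fun h => h.le⟩
    simp only [hu, if_true, h0]
    split_ifs <;> ring
  · have : ν ≠ u := fun h => hu h.ge
    simp [hu, this]

lemma tsum_localTerm_shift {f g : ℕ → ℕ → ℂ} {u : ℕ × ℕ} (hg : IsLocalShift u f g)
    {p : Nat.Primes} (hf : Summable fun ν : ℕ × ℕ => localTerm f p ν) :
    ∑' ν, localTerm g p ν = (1 - 1 / ((p : ℕ) : ℂ)) * ∑' ν, localTerm f p ν := by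
  have h1 : Summable fun ν : ℕ × ℕ => 1 / ((p : ℕ) : ℂ) * localTerm f p ν := hf.mul_left _
  simp only [hg p]
  rw [hf.tsum_sub (summable_shift h1 u), tsum_shift fun ν => 1 / ((p : ℕ) : ℂ) * localTerm f p ν,
    tsum_mul_left]
  ring

/-- Only the divisors `1` and `p` count, since `μ` vanishes on higher powers of `p`. -/
lemma sum_divisorsAntidiagonal_moebius {p : ℕ} (hp : p.Prime) (a : ℕ) (F : ℕ → ℂ) :
    ∑ x ∈ (p ^ a).divisorsAntidiagonal, (ArithmeticFunction.moebius x.1 : ℂ) * F x.1 =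
      F 1 - if 1 ≤ a then F p else 0 := by
  rw [Nat.sum_divisorsAntidiagonal fun d _ => (ArithmeticFunction.moebius d : ℂ) * F d,
    Nat.sum_divisors_prime_pow hp]
  rcases a with _ | a
  · simp
  · rw [Finset.sum_range_succ', Finset.sum_range_succ',
      Finset.sum_eq_zero fun i _ => ?_]
    · simp [ArithmeticFunction.moebius_apply_prime hp]
      ring
    · rw [ArithmeticFunction.moebius_apply_prime_pow hp (by omega), if_neg (by omega)]
      simp

lemma convFst_eq_sum_div (c : ArithmeticFunction ℂ) (f : ℕ → ℕ → ℂ) (n₁ n₂ : ℕ) :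
    convFst c f n₁ n₂ = ∑ x ∈ n₁.divisorsAntidiagonal, c x.1 * f (n₁ / x.1) n₂ := by
  rw [convFst_eq_sum]
  refine Finset.sum_congr rfl fun x hx => ?_
  have h := Nat.pos_of_ne_zero (Nat.left_ne_zero_of_mem_divisorsAntidiagonal hx)
  rw [← (Nat.mem_divisorsAntidiagonal.1 hx).1, Nat.mul_div_cancel_left _ h]

lemma isLocalShift_convFst (f : ℕ → ℕ → ℂ) :
    IsLocalShift (1, 0) f (convFst (ArithmeticFunction.moebius : ArithmeticFunction ℂ) f) := by
  rintro p ⟨a, b⟩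
  have hp : ((p : ℕ) : ℂ) ≠ 0 := Nat.cast_ne_zero.2 p.2.ne_zero
  simp only [localTerm, convFst_eq_sum_div, ArithmeticFunction.intCoe_apply]
  rw [sum_divisorsAntidiagonal_moebius p.2 a fun d => f ((p : ℕ) ^ a / d) ((p : ℕ) ^ b)]
  rcases a with _ | a
  · simp
  · simp [Nat.pow_succ, Nat.mul_div_cancel _ p.2.pos, Prod.mk_le_mk]
    field_simp
    ring

lemma isLocalShift_convSnd (f : ℕ → ℕ → ℂ) :
    IsLocalShift (0, 1) f (convSnd (ArithmeticFunction.moebius : ArithmeticFunction ℂ) f) := by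
  rintro p ⟨a, b⟩
  have := isLocalShift_convFst (fun a b => f b a) p (b, a)
  simp only [localTerm, convSnd, Prod.mk_le_mk, zero_le, and_true, true_and, Prod.mk_sub_mk,
    tsub_zero] at this ⊢
  rw [add_comm b a, add_comm (b - 1) a] at this
  exact this

/-- Lowering both exponents by one costs `1/p²` in the normalisation, and the weight `p` of
`idMoebius` at `p` restores one factor, leaving `1/p`. -/
lemma isLocalShift_convDiag (f : ℕ → ℕ → ℂ) :
    IsLocalShift (1, 1) f (convDiag idMoebius f) := by
  rintro p ⟨a, b⟩
  have hp : ((p : ℕ) : ℂ) ≠ 0 := Nat.cast_ne_zero.2 p.2.ne_zero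
  have hg : Nat.gcd ((p : ℕ) ^ a) ((p : ℕ) ^ b) = (p : ℕ) ^ min a b := by
    rcases le_total a b with h | h
    · rw [min_eq_left h, Nat.gcd_eq_left (pow_dvd_pow _ h)]
    · rw [min_eq_right h, Nat.gcd_eq_right (pow_dvd_pow _ h)]
  simp only [localTerm, convDiag, hg, idMoebius, ArithmeticFunction.coe_mk]
  have h := sum_divisorsAntidiagonal_moebius p.2 (min a b)
    fun d => d * f ((p : ℕ) ^ a / d) ((p : ℕ) ^ b / d)
  rw [Finset.sum_congr rfl fun x _ => show
    (x.1 : ℂ) * (ArithmeticFunction.moebius x.1 : ℂ) * f ((p : ℕ) ^ a / x.1) ((p : ℕ) ^ b / x.1) =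
    (ArithmeticFunction.moebius x.1 : ℂ) * (x.1 * f ((p : ℕ) ^ a / x.1) ((p : ℕ) ^ b / x.1)) by ring, h]
  rcases a with _ | a
  · simp
  · rcases b with _ | b
    · simp
    · simp [Nat.pow_succ, Nat.mul_div_cancel _ p.2.pos, Prod.mk_le_mk]
      field_simp
      ring

/-- The function on exponent pairs with values `a`, `b`, `c` at `(1, 0)`, `(0, 1)`, `(1, 1)`. -/
def leadingCoeff (a b c : ℂ) (ν : ℕ × ℕ) : ℂ :=
  (if ν = (1, 0) then a else 0) + (if ν = (0, 1) then b else 0) + if ν = (1, 1) then c else 0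

lemma summable_leadingCoeff (a b c : ℂ) : Summable (leadingCoeff a b c) := by
  refine summable_of_ne_finset_zero (s := {(1, 0), (0, 1), (1, 1)}) fun ν hν => ?_
  simp only [Finset.mem_insert, Finset.mem_singleton, not_or] at hν
  simp [leadingCoeff, hν]

lemma LocallyNear.convFst_moebius {f : ℕ → ℕ → ℂ} {a b c : ℂ}
    (h : LocallyNear f (leadingCoeff a b c)) :
    LocallyNear (convFst (ArithmeticFunction.moebius : ArithmeticFunction ℂ) f)
      (leadingCoeff (a - 1) b c) := by
  convert h.shift (summable_leadingCoeff a b c) (isLocalShift_convFst f) using 1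
  ext ν
  simp only [leadingCoeff]
  split_ifs <;> ring

lemma LocallyNear.convSnd_moebius {f : ℕ → ℕ → ℂ} {a b c : ℂ}
    (h : LocallyNear f (leadingCoeff a b c)) :
    LocallyNear (convSnd (ArithmeticFunction.moebius : ArithmeticFunction ℂ) f)
      (leadingCoeff a (b - 1) c) := by
  convert h.shift (summable_leadingCoeff a b c) (isLocalShift_convSnd f) using 1
  ext ν
  simp only [leadingCoeff]
  split_ifs <;> ring

lemma LocallyNear.convDiag_idMoebius {f : ℕ → ℕ → ℂ} {a b c : ℂ}
    (h : LocallyNear f (leadingCoeff a b c)) :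
    LocallyNear (convDiag idMoebius f) (leadingCoeff a b (c - 1)) := by
  convert h.shift (summable_leadingCoeff a b c) (isLocalShift_convDiag f) using 1
  ext ν
  simp only [leadingCoeff]
  split_ifs <;> ring

lemma isMultiplicative_moebius_pow (k : ℕ) :
    ((ArithmeticFunction.moebius : ArithmeticFunction ℂ) ^ k).IsMultiplicative := by
  induction k with
  | zero => exact ArithmeticFunction.isMultiplicative_one
  | succ k ih =>
    rw [pow_succ]
    exact ih.mul ArithmeticFunction.isMultiplicative_moebius.intCast

lemma localTerm_convFst_one (f : ℕ → ℕ → ℂ) (p : Nat.Primes) (ν : ℕ × ℕ) :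
    localTerm (convFst 1 f) p ν = localTerm f p ν := by
  rw [localTerm, convFst_one _ _ (pow_ne_zero _ p.2.ne_zero), localTerm]

lemma LocallyNear.convFst_moebius_pow {f : ℕ → ℕ → ℂ} {a b c : ℂ}
    (h : LocallyNear f (leadingCoeff a b c)) (k : ℕ) :
    LocallyNear (convFst ((ArithmeticFunction.moebius : ArithmeticFunction ℂ) ^ k) f)
      (leadingCoeff (a - k) b c) ∧
    ∀ p : Nat.Primes,
      ∑' ν, localTerm (convFst ((ArithmeticFunction.moebius : ArithmeticFunction ℂ) ^ k) f) p ν =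
        (1 - 1 / ((p : ℕ) : ℂ)) ^ k * ∑' ν, localTerm f p ν := by
  induction k with
  | zero => simpa [LocallyNear, localTerm_convFst_one] using h
  | succ k ih =>
    rw [pow_succ', ← convFst_convFst]
    constructor
    · convert! ih.1.convFst_moebius using 2
      push_cast
      ring
    · intro p
      rw [tsum_localTerm_shift (isLocalShift_convFst _)
        (ih.1.summable_localTerm (summable_leadingCoeff _ _ _) p), ih.2, pow_succ', mul_assoc]

lemma LocallyNear.convSnd_moebius_pow {f : ℕ → ℕ → ℂ} {a b c : ℂ}
    (h : LocallyNear f (leadingCoeff a b c)) (k : ℕ) :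
    LocallyNear (convSnd ((ArithmeticFunction.moebius : ArithmeticFunction ℂ) ^ k) f)
      (leadingCoeff a (b - k) c) ∧
    ∀ p : Nat.Primes,
      ∑' ν, localTerm (convSnd ((ArithmeticFunction.moebius : ArithmeticFunction ℂ) ^ k) f) p ν =
        (1 - 1 / ((p : ℕ) : ℂ)) ^ k * ∑' ν, localTerm f p ν := by
  induction k with
  | zero =>
    have h1 : ∀ (p : Nat.Primes) (ν : ℕ × ℕ), localTerm (convSnd 1 f) p ν = localTerm f p ν := by
      intro p ν
      rw [localTerm, convSnd, convFst_one _ _ (pow_ne_zero _ p.2.ne_zero), localTerm]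
    simpa [LocallyNear, h1] using h
  | succ k ih =>
    have h1 : convSnd ((ArithmeticFunction.moebius : ArithmeticFunction ℂ) ^ (k + 1)) f =
        convSnd (ArithmeticFunction.moebius : ArithmeticFunction ℂ)
          (convSnd ((ArithmeticFunction.moebius : ArithmeticFunction ℂ) ^ k) f) := by
      ext n₁ n₂
      simp only [convSnd]
      rw [pow_succ', ← convFst_convFst]
    rw [h1]
    constructor
    · convert! ih.1.convSnd_moebius using 2
      push_cast
      ring
    · intro p
      rw [tsum_localTerm_shift (isLocalShift_convSnd _)
        (ih.1.summable_localTerm (summable_leadingCoeff _ _ _) p), ih.2, pow_succ', mul_assoc]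

/-! ### From the hypotheses to summable local errors -/

/-- Mirrors the shape of both conditions: `S` holds the exponents under the inner series, and `s`
the finitely many exponents whose terms are controlled separately. `E` is the sum of its
restrictions to `S` and to the single slices. -/
lemma summable_prod_of_slices {ι κ : Type*} [DecidableEq κ] {E : ι × κ → ℂ} (S : Set κ)
    (s : Finset κ) (hd : ∀ ν ∈ s, ν ∉ S) (hz : ∀ i ν, ν ∉ S → ν ∉ s → E (i, ν) = 0)
    (hs : ∀ ν ∈ s, Summable fun i => E (i, ν)) (h1 : ∀ i, Summable fun ν : S => ‖E (i, ν)‖)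
    (h2 : Summable fun i => ∑' ν : S, ‖E (i, ν)‖) : Summable E := by
  classical
  have hS : Summable fun q : ι × S => E (q.1, q.2) := by
    refine Summable.of_norm ((summable_prod_of_nonneg fun q => norm_nonneg _).2 ⟨h1, h2⟩)
  have hS' : Summable fun q : ι × κ => if q.2 ∈ S then E q else 0 := by
    have hinj : Function.Injective fun q : ι × S => (q.1, (q.2 : κ)) := by
      rintro ⟨a, b⟩ ⟨c, d⟩ h
      simpa [Subtype.ext_iff] using h
    refine (hinj.summable_iff fun q hq => ?_).1 ?_
    · exact if_neg fun h => hq ⟨(q.1, ⟨q.2, h⟩), rfl⟩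
    · simpa [Function.comp_def] using hS
  have hs' : ∀ ν ∈ s, Summable fun q : ι × κ => if q.2 = ν then E q else 0 := by
    intro ν hν
    have hinj : Function.Injective fun i : ι => (i, ν) := fun a b h => (Prod.mk.inj h).1
    refine (hinj.summable_iff fun q hq => ?_).1 ?_
    · exact if_neg fun h => hq ⟨q.1, by simp [← h]⟩
    · simpa [Function.comp_def] using hs ν hν
  refine (hS'.add (summable_sum hs')).congr fun q => ?_
  obtain ⟨i, ν⟩ := q
  simp only [Finset.sum_ite_eq]
  by_cases hν : ν ∈ s
  · simp [hν, hd ν hν]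
  · by_cases hν' : ν ∈ S
    · simp [hν, hν']
    · simp [hν, hν', hz i ν hν' hν]

/-- Multiplicativity forces `f 1 1` to be `0` or `1`. If it were `0`, then `f p 1 = 0` for every
prime, and the hypothesis would make `∑ k/p` converge, which is false for `k ≥ 1`. -/
lemma IsMultiplicativeTwo.apply_one_one {f : ℕ → ℕ → ℂ} (hf : IsMultiplicativeTwo f) {k : ℕ}
    (hk : 1 ≤ k) (h : Summable fun p : Nat.Primes => (f p 1 - k) / ((p : ℕ) : ℂ)) : f 1 1 = 1 := by
  have h1 : f 1 1 = f 1 1 * f 1 1 := hf 1 1 1 1 one_pos one_pos one_pos one_pos rfl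
  by_contra hne
  have h0 : f 1 1 = 0 := by
    by_contra h0
    exact hne (mul_left_cancel₀ h0 (by rw [← h1, mul_one]))
  refine Nat.Primes.not_summable_one_div ?_
  have h2 : ∀ p : Nat.Primes, f p 1 = 0 := by
    intro p
    have := hf p 1 1 1 p.2.pos one_pos one_pos one_pos (by simp)
    simpa [h0] using this
  refine Summable.of_nonneg_of_le (fun p => by positivity) (fun p => ?_) h.norm
  rw [h2, zero_sub, norm_div, norm_neg, Complex.norm_natCast, Complex.norm_natCast]
  gcongr
  exact_mod_cast hk

lemma localTerm_sub_fst {f : ℕ → ℕ → ℂ} {k : ℂ} (p : Nat.Primes) :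
    localTerm f p (1, 0) - k / ((p : ℕ) : ℂ) = (f p 1 - k) / ((p : ℕ) : ℂ) := by
  simp [localTerm, sub_div]

lemma localTerm_sub_snd {f : ℕ → ℕ → ℂ} {k : ℂ} (p : Nat.Primes) :
    localTerm f p (0, 1) - k / ((p : ℕ) : ℂ) = (f 1 p - k) / ((p : ℕ) : ℂ) := by
  simp [localTerm, sub_div]

lemma localTerm_sub_diag {f : ℕ → ℕ → ℂ} (p : Nat.Primes) :
    localTerm f p (1, 1) - 1 / ((p : ℕ) : ℂ) = (f p p - (p : ℕ)) / ((p : ℕ) : ℂ) ^ 2 := by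
  have hp : ((p : ℕ) : ℂ) ≠ 0 := Nat.cast_ne_zero.2 p.2.ne_zero
  simp [localTerm]
  field_simp

lemma ConditionOne.locallyNear {f : ℕ → ℕ → ℂ} {k : ℕ} (h : ConditionOne f k)
    (hf : IsMultiplicativeTwo f) (hk : 1 ≤ k) :
    f 1 1 = 1 ∧ LocallyNear f (leadingCoeff k k 0) := by
  obtain ⟨h1, h2⟩ := h
  have hn : ∀ p : Nat.Primes, 0 ≤ ∑' ν : {ν : ℕ × ℕ // 2 ≤ ν.1 + ν.2}, ‖localTerm f p ν.1‖ :=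
    fun p => tsum_nonneg fun _ => norm_nonneg _
  have h10 : Summable fun p : Nat.Primes => (f p 1 - k) / ((p : ℕ) : ℂ) := by
    refine Summable.of_norm_bounded h2 fun p => ?_
    rw [norm_div, Complex.norm_natCast]
    have : ‖f p 1 - k‖ / (p : ℝ) ≤ (‖f p 1 - k‖ + ‖f 1 p - k‖) / (p : ℝ) := by
      gcongr
      linarith [norm_nonneg (f 1 p - k)]
    linarith [hn p]
  have h01 : Summable fun p : Nat.Primes => (f 1 p - k) / ((p : ℕ) : ℂ) := by
    refine Summable.of_norm_bounded h2 fun p => ?_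
    rw [norm_div, Complex.norm_natCast]
    have : ‖f 1 p - k‖ / (p : ℝ) ≤ (‖f p 1 - k‖ + ‖f 1 p - k‖) / (p : ℝ) := by
      gcongr
      linarith [norm_nonneg (f p 1 - k)]
    linarith [hn p]
  have h11 := hf.apply_one_one hk h10
  refine ⟨h11, ?_⟩
  have hE : ∀ (p : Nat.Primes) (ν : {ν : ℕ × ℕ // 2 ≤ ν.1 + ν.2}), localTerm f p ν.1 -
      (if ν.1 = 0 then 1 else 0) - leadingCoeff k k 0 ν.1 / ((p : ℕ) : ℂ) = localTerm f p ν.1 := by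
    rintro p ⟨ν, hν⟩
    have e1 : ν ≠ 0 := by rintro rfl; simp at hν
    have e2 : ν ≠ (1, 0) := by rintro rfl; simp at hν
    have e3 : ν ≠ (0, 1) := by rintro rfl; simp at hν
    simp [leadingCoeff, e1, e2, e3]
  refine summable_prod_of_slices {ν : ℕ × ℕ | 2 ≤ ν.1 + ν.2} {(1, 0), (0, 1)} ?_ ?_ ?_ ?_ ?_
  · simp
  · rintro p ⟨a, b⟩ hS hs
    simp only [Set.mem_ofPred_eq, not_le, Finset.mem_insert, Finset.mem_singleton, Prod.mk.injEq,
      not_or] at hS hs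
    obtain ⟨rfl, rfl⟩ : a = 0 ∧ b = 0 := by omega
    simp [leadingCoeff, localTerm, h11]
  · intro ν hν
    simp only [Finset.mem_insert, Finset.mem_singleton] at hν
    rcases hν with rfl | rfl
    · refine h10.congr fun p => ?_
      simp [leadingCoeff, ← localTerm_sub_fst]
    · refine h01.congr fun p => ?_
      simp [leadingCoeff, ← localTerm_sub_snd]
  · exact fun p => (h1 p).congr fun ν => (congrArg norm (hE p ν)).symm
  · refine Summable.of_nonneg_of_le (fun p => tsum_nonneg fun _ => norm_nonneg _) (fun p => ?_) h2
    exact (tsum_congr fun ν => congrArg norm (hE p ν)).trans_le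
      (le_add_of_nonneg_left (by positivity))

lemma ConditionTwo.locallyNear {f : ℕ → ℕ → ℂ} {k : ℕ} (h : ConditionTwo f k)
    (hf : IsMultiplicativeTwo f) (hk : 1 ≤ k) :
    f 1 1 = 1 ∧ LocallyNear f (leadingCoeff k k 1) := by
  obtain ⟨h1, h2⟩ := h
  have hn : ∀ p : Nat.Primes, 0 ≤ ∑' ν : {ν : ℕ × ℕ // 2 ≤ ν.1 + ν.2 ∧ ν ≠ (1, 1)},
      ‖localTerm f p ν.1‖ := fun p => tsum_nonneg fun _ => norm_nonneg _
  have hp2 : ∀ p : Nat.Primes, 0 ≤ ‖f p p - (p : ℂ)‖ / (p : ℝ) ^ 2 := fun p => by positivity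
  have h10 : Summable fun p : Nat.Primes => (f p 1 - k) / ((p : ℕ) : ℂ) := by
    refine Summable.of_norm_bounded h2 fun p => ?_
    rw [norm_div, Complex.norm_natCast]
    have : ‖f p 1 - k‖ / (p : ℝ) ≤ (‖f p 1 - k‖ + ‖f 1 p - k‖) / (p : ℝ) := by
      gcongr
      linarith [norm_nonneg (f 1 p - k)]
    linarith [hn p, hp2 p]
  have h01 : Summable fun p : Nat.Primes => (f 1 p - k) / ((p : ℕ) : ℂ) := by
    refine Summable.of_norm_bounded h2 fun p => ?_
    rw [norm_div, Complex.norm_natCast]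
    have : ‖f 1 p - k‖ / (p : ℝ) ≤ (‖f p 1 - k‖ + ‖f 1 p - k‖) / (p : ℝ) := by
      gcongr
      linarith [norm_nonneg (f p 1 - k)]
    linarith [hn p, hp2 p]
  have hpp : Summable fun p : Nat.Primes => (f p p - (p : ℕ)) / ((p : ℕ) : ℂ) ^ 2 := by
    refine Summable.of_norm_bounded h2 fun p => ?_
    rw [norm_div, norm_pow, Complex.norm_natCast]
    have : 0 ≤ (‖f p 1 - k‖ + ‖f 1 p - k‖) / (p : ℝ) := by positivity
    linarith [hn p]
  have h11 := hf.apply_one_one hk h10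
  refine ⟨h11, ?_⟩
  have hE : ∀ (p : Nat.Primes) (ν : {ν : ℕ × ℕ // 2 ≤ ν.1 + ν.2 ∧ ν ≠ (1, 1)}), localTerm f p ν.1 -
      (if ν.1 = 0 then 1 else 0) - leadingCoeff k k 1 ν.1 / ((p : ℕ) : ℂ) = localTerm f p ν.1 := by
    rintro p ⟨ν, hν, e4⟩
    have e1 : ν ≠ 0 := by rintro rfl; simp at hν
    have e2 : ν ≠ (1, 0) := by rintro rfl; simp at hν
    have e3 : ν ≠ (0, 1) := by rintro rfl; simp at hν
    simp [leadingCoeff, e1, e2, e3, e4]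
  refine summable_prod_of_slices {ν : ℕ × ℕ | 2 ≤ ν.1 + ν.2 ∧ ν ≠ (1, 1)} {(1, 0), (0, 1), (1, 1)}
    ?_ ?_ ?_ ?_ ?_
  · simp
  · rintro p ⟨a, b⟩ hS hs
    simp only [Set.mem_ofPred_eq, Finset.mem_insert, Finset.mem_singleton, Prod.mk.injEq,
      not_or, ne_eq] at hS hs
    obtain ⟨rfl, rfl⟩ : a = 0 ∧ b = 0 := by omega
    simp [leadingCoeff, localTerm, h11]
  · intro ν hν
    simp only [Finset.mem_insert, Finset.mem_singleton] at hν
    rcases hν with rfl | rfl | rfl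
    · refine h10.congr fun p => ?_
      simp [leadingCoeff, ← localTerm_sub_fst]
    · refine h01.congr fun p => ?_
      simp [leadingCoeff, ← localTerm_sub_snd]
    · refine hpp.congr fun p => ?_
      rw [← localTerm_sub_diag]
      simp [leadingCoeff]
  · exact fun p => (h1 p).congr fun ν => (congrArg norm (hE p ν)).symm
  · refine Summable.of_nonneg_of_le (fun p => tsum_nonneg fun _ => norm_nonneg _) (fun p => ?_) h2
    exact (tsum_congr fun ν => congrArg norm (hE p ν)).trans_le
      (le_add_of_nonneg_left (by positivity))

/-! ### Euler products in two variables -/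

/-- The sum of `H (a, b)` over the factorisations `a * b = n`. -/
def sumFactorisations {R : Type*} [AddCommMonoid R] (H : ℕ × ℕ → R) (n : ℕ) : R :=
  ∑ x ∈ n.divisorsAntidiagonal, H x

/-- Grouping pairs by their product turns a multiplicative function of two variables into one of a
single variable, for which the Euler product is available. -/
lemma sumFactorisations_mul {R : Type*} [CommSemiring R] {H : ℕ × ℕ → R}
    (hH : ∀ m₁ m₂ n₁ n₂ : ℕ, 0 < m₁ → 0 < m₂ → 0 < n₁ → 0 < n₂ →
      Nat.gcd (m₁ * m₂) (n₁ * n₂) = 1 → H (m₁ * n₁, m₂ * n₂) = H (m₁, m₂) * H (n₁, n₂))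
    {m n : ℕ} (h : m.Coprime n) :
    sumFactorisations H (m * n) = sumFactorisations H m * sumFactorisations H n := by
  simp only [sumFactorisations]
  rw [sum_divisorsAntidiagonal_mul h, Finset.sum_mul_sum]
  refine Finset.sum_congr rfl fun x hx => Finset.sum_congr rfl fun y hy => ?_
  have hx1 := Nat.pos_of_ne_zero (Nat.left_ne_zero_of_mem_divisorsAntidiagonal hx)
  have hx2 := Nat.pos_of_ne_zero (Nat.right_ne_zero_of_mem_divisorsAntidiagonal hx)
  have hy1 := Nat.pos_of_ne_zero (Nat.left_ne_zero_of_mem_divisorsAntidiagonal hy)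
  have hy2 := Nat.pos_of_ne_zero (Nat.right_ne_zero_of_mem_divisorsAntidiagonal hy)
  rw [Nat.mem_divisorsAntidiagonal] at hx hy
  exact hH _ _ _ _ hx1 hx2 hy1 hy2 (by rw [hx.1, hy.1]; exact h)

lemma sumFactorisations_prime_pow {R : Type*} [AddCommMonoid R] (H : ℕ × ℕ → R) {p : ℕ}
    (hp : p.Prime) (e : ℕ) :
    sumFactorisations H (p ^ e) = ∑ ν ∈ Finset.HasAntidiagonal.antidiagonal e, H (p ^ ν.1, p ^ ν.2) := by
  rw [sumFactorisations, Nat.sum_divisorsAntidiagonal fun a b => H (a, b),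
    Nat.sum_divisors_prime_pow hp, Finset.Nat.sum_antidiagonal_eq_sum_range_succ_mk]
  refine Finset.sum_congr rfl fun i hi => ?_
  rw [Nat.pow_div (Nat.lt_succ_iff.1 (Finset.mem_range.1 hi)) hp.pos]

lemma hasSum_sumFactorisations_prime_pow {R : Type*} [NormedAddCommGroup R] [CompleteSpace R]
    {H : ℕ × ℕ → R} {p : ℕ} (hp : p.Prime)
    (hs : Summable fun ν : ℕ × ℕ => ‖H (p ^ ν.1, p ^ ν.2)‖) :
    HasSum (fun e => sumFactorisations H (p ^ e)) (∑' ν : ℕ × ℕ, H (p ^ ν.1, p ^ ν.2)) := by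
  simp only [sumFactorisations_prime_pow H hp]
  have h1 := (Finset.HasAntidiagonal.sigmaAntidiagonalEquivProd (A := ℕ)).hasSum_iff.2 hs.of_norm.hasSum
  refine h1.sigma fun e => ?_
  exact Finset.hasSum (Finset.HasAntidiagonal.antidiagonal e) fun ν : ℕ × ℕ => H (p ^ ν.1, p ^ ν.2)

/-- Euler product for a multiplicative function of two variables. -/
lemma summable_and_hasProd_of_multiplicative {H : ℕ × ℕ → ℂ} (h11 : H (1, 1) = 1)
    (h0 : ∀ a b, a * b = 0 → H (a, b) = 0)
    (hH : ∀ m₁ m₂ n₁ n₂ : ℕ, 0 < m₁ → 0 < m₂ → 0 < n₁ → 0 < n₂ →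
      Nat.gcd (m₁ * m₂) (n₁ * n₂) = 1 → H (m₁ * n₁, m₂ * n₂) = H (m₁, m₂) * H (n₁, n₂))
    (hs : Summable fun q : Nat.Primes × (ℕ × ℕ) =>
      H ((q.1 : ℕ) ^ q.2.1, (q.1 : ℕ) ^ q.2.2) - if q.2 = 0 then 1 else 0) :
    Summable H ∧ HasProd
      (fun p : Nat.Primes => ∑' ν : ℕ × ℕ, H ((p : ℕ) ^ ν.1, (p : ℕ) ^ ν.2)) (∑' q, H q) := by
  -- Absolute convergence comes first: the grouped sums of `K = ‖H‖` are nonnegative and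
  -- multiplicative, and they dominate those of `H`.
  set K : ℕ × ℕ → ℝ := fun q => ‖H q‖ with hK
  have hK11 : K (1, 1) = 1 := by simp [hK, h11]
  have hKm : ∀ m₁ m₂ n₁ n₂ : ℕ, 0 < m₁ → 0 < m₂ → 0 < n₁ → 0 < n₂ →
      Nat.gcd (m₁ * m₂) (n₁ * n₂) = 1 → K (m₁ * n₁, m₂ * n₂) = K (m₁, m₂) * K (n₁, n₂) := by
    intro m₁ m₂ n₁ n₂ h1 h2 h3 h4 h
    simp only [hK]
    rw [hH _ _ _ _ h1 h2 h3 h4 h, norm_mul]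
  have hsplit : ∀ p : Nat.Primes, ∀ ν : ℕ × ℕ, K ((p : ℕ) ^ ν.1, (p : ℕ) ^ ν.2) =
      ‖H ((p : ℕ) ^ ν.1, (p : ℕ) ^ ν.2) - if ν = 0 then 1 else 0‖ + if ν = 0 then 1 else 0 := by
    intro p ν
    split_ifs with h
    · simp [hK, h, h11]
    · simp [hK]
  have hsn := (summable_prod_of_nonneg fun q => norm_nonneg _).1 hs.norm
  set ε : Nat.Primes → ℝ := fun p =>
    ∑' ν : ℕ × ℕ, ‖H ((p : ℕ) ^ ν.1, (p : ℕ) ^ ν.2) - if ν = 0 then 1 else 0‖ with hε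
  have hεs : Summable ε := hsn.2
  have hε0 : ∀ p, 0 ≤ ε p := fun p => tsum_nonneg fun _ => norm_nonneg _
  have hKs : ∀ p : Nat.Primes, HasSum (fun ν : ℕ × ℕ => K ((p : ℕ) ^ ν.1, (p : ℕ) ^ ν.2)) (ε p + 1) := by
    intro p
    rw [funext (hsplit p)]
    exact (hsn.1 p).hasSum.add (hasSum_ite_eq (0 : ℕ × ℕ) (1 : ℝ))
  have hKs' : ∀ p : Nat.Primes, Summable fun ν : ℕ × ℕ => ‖K ((p : ℕ) ^ ν.1, (p : ℕ) ^ ν.2)‖ := by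
    intro p
    simpa [hK] using (hKs p).summable
  have hQ : ∀ p : Nat.Primes, HasSum (fun e => sumFactorisations K ((p : ℕ) ^ e)) (ε p + 1) := by
    intro p
    rw [← (hKs p).tsum_eq]
    exact hasSum_sumFactorisations_prime_pow p.2 (hKs' p)
  have hQ0 : ∀ n, 0 ≤ sumFactorisations K n := fun n => Finset.sum_nonneg fun _ _ => norm_nonneg _
  have hQ1 : sumFactorisations K 1 = 1 := by simp [sumFactorisations, hK11]
  -- Each factor is `1 + ε p ≤ exp (ε p)`, so all partial products are bounded by the exponential of
  -- the convergent sum of the `ε p`.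
  have hbound : ∀ N, ∏ p ∈ Nat.primesBelow N, ∑' e, sumFactorisations K (p ^ e) ≤
      Real.exp (∑' p, ε p) := by
    intro N
    obtain ⟨s, hs⟩ : ∃ s : Finset Nat.Primes,
        s.map ⟨fun p : Nat.Primes => (p : ℕ), Nat.Primes.coe_nat_injective⟩ = Nat.primesBelow N :=
      ⟨(Nat.primesBelow N).subtype Nat.Prime,
        Finset.subtype_map_of_mem fun p hp => Nat.prime_of_mem_primesBelow hp⟩
    rw [← hs, Finset.prod_map]
    calc _ ≤ ∏ p ∈ s, Real.exp (ε p) := by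
          refine Finset.prod_le_prod (fun p _ => tsum_nonneg fun _ => hQ0 _) fun p _ => ?_
          exact (hQ p).tsum_eq.trans_le (Real.add_one_le_exp _)
      _ = Real.exp (∑ p ∈ s, ε p) := (Real.exp_sum _ _).symm
      _ ≤ _ := Real.exp_le_exp.2 (hεs.sum_le_tsum _ fun p _ => hε0 p)
  have hQsum : Summable (sumFactorisations K) := by
    refine summable_of_sum_le (c := Real.exp (∑' p, ε p)) hQ0 fun u => ?_
    -- Positive integers below `N` are `N`-smooth, so the partial sum over `u` is at most the finite
    -- Euler product over primes below `N`.
    obtain ⟨N, hN⟩ := u.exists_nat_subset_range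
    have hsm := EulerProduct.summable_and_hasSum_smoothNumbers_prod_primesBelow_tsum hQ1
      (fun h => sumFactorisations_mul hKm h)
      (fun {p} hp => (hQ ⟨p, hp⟩).summable.norm) N
    refine le_trans ?_ (hbound N)
    have hz : sumFactorisations K 0 = 0 := by simp [sumFactorisations]
    calc ∑ n ∈ u, sumFactorisations K n
        = ∑ n ∈ u.erase 0, sumFactorisations K n := (Finset.sum_erase u hz).symm
      _ = ∑ n ∈ (u.erase 0).subtype (· ∈ N.smoothNumbers), sumFactorisations K n := by
          rw [Finset.sum_subtype_of_mem]
          intro n hn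
          rw [Finset.mem_erase] at hn
          exact Nat.mem_smoothNumbers_of_lt (Nat.pos_of_ne_zero hn.1) (Finset.mem_range.1 (hN hn.2))
      _ ≤ _ := sum_le_hasSum _ (fun n _ => hQ0 n) hsm.2
  have hHs : Summable H := by
    refine Summable.of_norm (summable_of_sum_le (c := ∑' n, sumFactorisations K n)
      (fun _ => norm_nonneg _) fun u => ?_)
    classical
    -- A finite set of pairs is sorted by product; each fibre over `n ≠ 0` lies among the
    -- factorisations of `n`, and over `n = 0` the function `H` vanishes.
    rw [← Finset.sum_fiberwise_of_maps_to (t := u.image fun q => q.1 * q.2)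
      (fun q hq => Finset.mem_image_of_mem _ hq)]
    refine le_trans (Finset.sum_le_sum fun n hn => ?_) (hQsum.sum_le_tsum _ fun n _ => hQ0 n)
    rcases eq_or_ne n 0 with rfl | hn0
    · rw [Finset.sum_eq_zero]
      · exact hQ0 _
      · intro q hq
        rw [h0 q.1 q.2 (Finset.mem_filter.1 hq).2, norm_zero]
    · refine Finset.sum_le_sum_of_subset_of_nonneg (fun q hq => ?_) fun _ _ _ => norm_nonneg _
      exact Nat.mem_divisorsAntidiagonal.2 ⟨(Finset.mem_filter.1 hq).2, hn0⟩
  refine ⟨hHs, ?_⟩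
  have hfib : HasSum (sumFactorisations H) (∑' q, H q) := by
    suffices hfun : sumFactorisations H =
        fun n => ∑' q : (fun q : ℕ × ℕ => q.1 * q.2) ⁻¹' {n}, H q by
      rw [hfun]
      exact hHs.hasSum.tsum_fiberwise (fun q => q.1 * q.2)
    ext n
    rcases eq_or_ne n 0 with rfl | hn0
    · rw [sumFactorisations, Nat.divisorsAntidiagonal_zero, Finset.sum_empty, eq_comm]
      convert tsum_zero with q
      exact h0 _ _ q.2
    · have hset : (fun q : ℕ × ℕ => q.1 * q.2) ⁻¹' {n} = (n.divisorsAntidiagonal : Set (ℕ × ℕ)) := by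
        ext q
        simp [hn0]
      rw [hset, Finset.tsum_subtype', sumFactorisations]
  have hep := EulerProduct.eulerProduct_hasProd (f := sumFactorisations H)
    (by simp [sumFactorisations, h11]) (fun h => sumFactorisations_mul hH h)
    (Summable.of_nonneg_of_le (fun n => norm_nonneg _) (fun n => norm_sum_le _ _) hQsum)
    (by simp [sumFactorisations])
  rw [hfib.tsum_eq] at hep
  convert hep using 2 with p
  refine (hasSum_sumFactorisations_prime_pow p.2 ?_).tsum_eq.symm
  simpa [hK] using hKs' p

/-! ### Sums of powers of logarithms and logarithmic asymptotics -/

lemma pow_succ_sub_pow_succ_le {u v : ℝ} (hv : 0 ≤ v) (huv : v ≤ u) (j : ℕ) :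
    u ^ (j + 1) - v ^ (j + 1) ≤ (j + 1) * u ^ j * (u - v) := by
  induction j with
  | zero => simp
  | succ j ih =>
    have h1 : v ^ (j + 1) * (u - v) ≤ u ^ (j + 1) * (u - v) :=
      mul_le_mul_of_nonneg_right (pow_le_pow_left₀ hv huv _) (sub_nonneg.2 huv)
    have h2 := mul_le_mul_of_nonneg_left ih (hv.trans huv)
    have e : u ^ (j + 1 + 1) - v ^ (j + 1 + 1) =
      u * (u ^ (j + 1) - v ^ (j + 1)) + v ^ (j + 1) * (u - v) := by ring
    have e' : ((j + 1 : ℕ) + 1 : ℝ) * u ^ (j + 1) * (u - v) =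
      u * ((j + 1) * u ^ j * (u - v)) + u ^ (j + 1) * (u - v) := by push_cast; ring
    rw [e, e']
    linarith

lemma le_pow_succ_sub_pow_succ {u v : ℝ} (hv : 0 ≤ v) (huv : v ≤ u) (j : ℕ) :
    (j + 1) * v ^ j * (u - v) ≤ u ^ (j + 1) - v ^ (j + 1) := by
  induction j with
  | zero => simp
  | succ j ih =>
    have h0 : 0 ≤ u ^ (j + 1) - v ^ (j + 1) := sub_nonneg.2 (pow_le_pow_left₀ hv huv _)
    have h1 := mul_le_mul_of_nonneg_right huv h0
    have h2 := mul_le_mul_of_nonneg_left ih hv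
    have e : u ^ (j + 1 + 1) - v ^ (j + 1 + 1) =
      u * (u ^ (j + 1) - v ^ (j + 1)) + v ^ (j + 1) * (u - v) := by ring
    have e' : ((j + 1 : ℕ) + 1 : ℝ) * v ^ (j + 1) * (u - v) =
      v * ((j + 1) * v ^ j * (u - v)) + v ^ (j + 1) * (u - v) := by push_cast; ring
    rw [e, e']
    linarith

lemma log_div_sub_log_div_succ {x : ℝ} (hx : 0 < x) {n : ℕ} (hn : 0 < n) :
    1 / ((n : ℝ) + 1) ≤ Real.log (x / n) - Real.log (x / (n + 1 : ℕ)) ∧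
      Real.log (x / n) - Real.log (x / (n + 1 : ℕ)) ≤ 1 / n := by
  have hn' : (0 : ℝ) < n := Nat.cast_pos.2 hn
  have h1 : (0 : ℝ) < n + 1 := by positivity
  push_cast
  rw [Real.log_div hx.ne' hn'.ne', Real.log_div hx.ne' h1.ne']
  constructor
  · have := Real.log_le_sub_one_of_pos (div_pos hn' h1)
    rw [Real.log_div hn'.ne' h1.ne'] at this
    have e : (n : ℝ) / (n + 1) - 1 = -(1 / ((n : ℝ) + 1)) := by field_simp; ring
    linarith
  · have := Real.log_le_sub_one_of_pos (div_pos h1 hn')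
    rw [Real.log_div h1.ne' hn'.ne'] at this
    have e : ((n : ℝ) + 1) / n - 1 = 1 / (n : ℝ) := by field_simp; ring
    linarith

lemma log_div_nat_nonneg {x : ℝ} {n : ℕ} (hn : 0 < n) (hnx : (n : ℝ) ≤ x) :
    0 ≤ Real.log (x / n) :=
  Real.log_nonneg ((one_le_div (Nat.cast_pos.2 hn)).2 hnx)

lemma log_div_nat_le {x : ℝ} (hx : 1 ≤ x) {n : ℕ} (hn : 0 < n) :
    Real.log (x / n) ≤ Real.log x :=
  Real.log_le_log (div_pos (by linarith) (Nat.cast_pos.2 hn))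
    (div_le_self (by linarith) (by exact_mod_cast hn))

/-- A discrete integral comparison: for `m ≥ 2`, `1/m ≤ log (x/(m-1)) - log (x/m)`, so the term at
`m` is at most the increment of `(log (x/t))^(j+1)/(j+1)` between these points, and the increments
telescope. The term `m = 1` is kept apart as `(log x)^j`. -/
lemma sum_log_div_pow_upper {x : ℝ} (hx : 1 ≤ x) (j n : ℕ) (hnx : ((n + 1 : ℕ) : ℝ) ≤ x) :
    ∑ m ∈ Finset.Ioc 0 (n + 1), 1 / (m : ℝ) * Real.log (x / m) ^ j ≤ Real.log x ^ j +
      (Real.log x ^ (j + 1) - Real.log (x / (n + 1 : ℕ)) ^ (j + 1)) / (j + 1) := by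
  induction n with
  | zero => simp
  | succ n ih =>
    have hle : ((n + 1 : ℕ) : ℝ) ≤ ((n + 1 + 1 : ℕ) : ℝ) := by push_cast; linarith
    have ih := ih (hle.trans hnx)
    rw [Finset.sum_Ioc_succ_top (Nat.zero_le _)]
    have hd := (log_div_sub_log_div_succ (x := x) (by linarith) (Nat.succ_pos n)).1
    have hv := log_div_nat_nonneg (Nat.succ_pos (n + 1)) hnx
    simp only [Nat.succ_eq_add_one] at hd hv
    set u := Real.log (x / (n + 1 : ℕ))
    set v := Real.log (x / (n + 1 + 1 : ℕ))
    have hd0 : (0 : ℝ) ≤ 1 / (((n + 1 : ℕ) : ℝ) + 1) := by positivity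
    have h1 := le_pow_succ_sub_pow_succ hv (by linarith : v ≤ u) j
    have hj : (0 : ℝ) < j + 1 := by positivity
    have h2 : 1 / ((n + 1 + 1 : ℕ) : ℝ) * v ^ j ≤ (u ^ (j + 1) - v ^ (j + 1)) / (j + 1) := by
      rw [le_div_iff₀ hj]
      have : 1 / ((n + 1 + 1 : ℕ) : ℝ) ≤ u - v := by push_cast at hd ⊢; exact hd
      calc 1 / ((n + 1 + 1 : ℕ) : ℝ) * v ^ j * (j + 1)
          ≤ (u - v) * v ^ j * (j + 1) := by gcongr
        _ = (j + 1) * v ^ j * (u - v) := by ring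
        _ ≤ _ := h1
    calc _ ≤ _ := add_le_add ih h2
      _ = _ := by ring

lemma sum_log_div_pow_lower {x : ℝ} (hx : 1 ≤ x) (j n : ℕ) (hnx : ((n + 1 : ℕ) : ℝ) ≤ x) :
    (Real.log x ^ (j + 1) - Real.log (x / (n + 1 : ℕ)) ^ (j + 1)) / (j + 1) ≤
      ∑ m ∈ Finset.Ioc 0 n, 1 / (m : ℝ) * Real.log (x / m) ^ j := by
  induction n with
  | zero => simp
  | succ n ih =>
    have hle : ((n + 1 : ℕ) : ℝ) ≤ ((n + 1 + 1 : ℕ) : ℝ) := by push_cast; linarith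
    have ih := ih (hle.trans hnx)
    rw [Finset.sum_Ioc_succ_top (Nat.zero_le _)]
    have hd := log_div_sub_log_div_succ (x := x) (by linarith) (Nat.succ_pos n)
    have hv := log_div_nat_nonneg (Nat.succ_pos (n + 1)) hnx
    simp only [Nat.succ_eq_add_one] at hd hv
    set u := Real.log (x / (n + 1 : ℕ))
    set v := Real.log (x / (n + 1 + 1 : ℕ))
    have hd0 : (0 : ℝ) ≤ 1 / (((n + 1 : ℕ) : ℝ) + 1) := by positivity
    have hvu : v ≤ u := by linarith [hd.1]
    have hu : 0 ≤ u := hv.trans hvu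
    have h1 := pow_succ_sub_pow_succ_le hv hvu j
    have hj : (0 : ℝ) < j + 1 := by positivity
    have h2 : (u ^ (j + 1) - v ^ (j + 1)) / (j + 1) ≤ 1 / ((n + 1 : ℕ) : ℝ) * u ^ j := by
      rw [div_le_iff₀ hj]
      calc _ ≤ _ := h1
        _ = (u - v) * u ^ j * (j + 1) := by ring
        _ ≤ _ := by gcongr; exact hd.2
    calc _ = _ := by ring
      _ ≤ _ := add_le_add ih h2

lemma abs_sum_log_div_pow_sub_le {x : ℝ} (hx : 1 ≤ x) (j : ℕ) :
    |∑ m ∈ Finset.Ioc 0 ⌊x⌋₊, 1 / (m : ℝ) * Real.log (x / m) ^ j -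
      Real.log x ^ (j + 1) / (j + 1)| ≤ 2 * (1 + Real.log x) ^ j := by
  obtain ⟨n, hn⟩ := Nat.exists_eq_succ_of_ne_zero (Nat.floor_pos.2 hx).ne'
  have hnx : ((n + 1 : ℕ) : ℝ) ≤ x := by
    rw [← Nat.succ_eq_add_one, ← hn]
    exact Nat.floor_le (by linarith)
  have hxn : x < (n + 1 : ℕ) + 1 := by
    rw [← Nat.succ_eq_add_one, ← hn]
    exact Nat.lt_floor_add_one x
  have hL : 0 ≤ Real.log x := Real.log_nonneg hx
  have hup := sum_log_div_pow_upper hx j n hnx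
  have hlo := sum_log_div_pow_lower hx j n hnx
  rw [hn, Nat.succ_eq_add_one]
  have hv := log_div_nat_nonneg (Nat.succ_pos n) hnx
  rw [Nat.succ_eq_add_one] at hv
  have hn0 : (0 : ℝ) < (n + 1 : ℕ) := by positivity
  -- Here `n + 1 = ⌊x⌋`, so `x / (n + 1) < 2` and the boundary term left by the telescoping is
  -- bounded.
  have hv1 : Real.log (x / (n + 1 : ℕ)) ≤ 1 := by
    refine (Real.log_le_sub_one_of_pos (div_pos (by linarith) hn0)).trans ?_
    rw [sub_le_iff_le_add, div_le_iff₀ hn0]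
    push_cast at hxn ⊢
    have : (0 : ℝ) ≤ n := Nat.cast_nonneg n
    linarith
  have hmono : ∑ m ∈ Finset.Ioc 0 n, 1 / (m : ℝ) * Real.log (x / m) ^ j ≤
      ∑ m ∈ Finset.Ioc 0 (n + 1), 1 / (m : ℝ) * Real.log (x / m) ^ j := by
    rw [Finset.sum_Ioc_succ_top (Nat.zero_le _)]
    exact le_add_of_nonneg_right (mul_nonneg (by positivity) (pow_nonneg hv _))
  have hj : (1 : ℝ) ≤ j + 1 := by linarith [(Nat.cast_nonneg j : (0 : ℝ) ≤ j)]
  have hvp : Real.log (x / (n + 1 : ℕ)) ^ (j + 1) / (j + 1) ≤ 1 :=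
    div_le_one_of_le₀ ((pow_le_one₀ hv hv1).trans hj) (by linarith)
  have hvp0 : 0 ≤ Real.log (x / (n + 1 : ℕ)) ^ (j + 1) / (j + 1) :=
    div_nonneg (pow_nonneg hv _) (by linarith)
  have h1 : 1 ≤ (1 + Real.log x) ^ j := one_le_pow₀ (by linarith)
  have h2 : Real.log x ^ j ≤ (1 + Real.log x) ^ j := pow_le_pow_left₀ hL (by linarith) j
  rw [sub_div] at hup hlo
  rw [abs_le]
  constructor <;> linarith

/-- `F` is bounded on bounded subsets of `[1, ∞)` and `F x ∼ c (log x) ^ j`. -/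
def LogAsymptotic (F : ℝ → ℂ) (j : ℕ) (c : ℂ) : Prop :=
  (∀ X : ℝ, ∃ K : ℝ, ∀ x, 1 ≤ x → x ≤ X → ‖F x‖ ≤ K) ∧
    Tendsto (fun x : ℝ => F x / (Real.log x : ℂ) ^ j) atTop (𝓝 c)

lemma norm_ofReal_log_pow {x : ℝ} (hx : 1 ≤ x) (j : ℕ) :
    ‖(Real.log x : ℂ) ^ j‖ = Real.log x ^ j := by
  rw [norm_pow, Complex.norm_real, Real.norm_of_nonneg (Real.log_nonneg hx)]

/-- The bounded range, where the asymptotic says nothing, is paid for by `K / x`. This shape suits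
later summation: at `x / m` with weight `1 / m` it becomes `K / x`, whose sum over `m ≤ x` is at
most `K`, without a logarithm. -/
lemma LogAsymptotic.exists_norm_sub_le {F : ℝ → ℂ} {j : ℕ} {c : ℂ} (h : LogAsymptotic F j c)
    {ε : ℝ} (hε : 0 < ε) : ∃ K : ℝ, 0 ≤ K ∧ ∀ x, 1 ≤ x →
      ‖F x - c * (Real.log x : ℂ) ^ j‖ ≤ ε * (1 + Real.log x) ^ j + K / x := by
  obtain ⟨X, hX⟩ := eventually_atTop.1 ((Metric.tendsto_nhds.1 h.2 ε hε).and
    (eventually_ge_atTop 2))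
  obtain ⟨K, hK⟩ := h.1 (max X 2)
  have hlog2 : 0 ≤ Real.log (max X 2) := Real.log_nonneg (by linarith [le_max_right X 2])
  have hX2 : 0 < max X 2 := by linarith [le_max_right X 2]
  refine ⟨(|K| + ‖c‖ * Real.log (max X 2) ^ j) * max X 2, by positivity, fun x hx => ?_⟩
  have hx0 : 0 < x := by linarith
  have hL := Real.log_nonneg hx
  rcases le_or_gt (max X 2) x with hxX | hxX
  · obtain ⟨h1, h2⟩ := hX x ((le_max_left _ _).trans hxX)
    have hLpos : 0 < Real.log x := Real.log_pos (by linarith)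
    have hL0 : (Real.log x : ℂ) ^ j ≠ 0 :=
      pow_ne_zero _ (Complex.ofReal_ne_zero.2 hLpos.ne')
    have e : F x - c * (Real.log x : ℂ) ^ j =
        (F x / (Real.log x : ℂ) ^ j - c) * (Real.log x : ℂ) ^ j := by
      rw [sub_mul, div_mul_cancel₀ _ hL0]
    rw [e, norm_mul, norm_ofReal_log_pow hx, ← dist_eq_norm]
    have h3 : dist (F x / (Real.log x : ℂ) ^ j) c * Real.log x ^ j ≤
        ε * (1 + Real.log x) ^ j := by
      gcongr
      linarith
    have h4 : 0 ≤ (|K| + ‖c‖ * Real.log (max X 2) ^ j) * max X 2 / x := by positivity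
    linarith
  · have h1 : ‖F x - c * (Real.log x : ℂ) ^ j‖ ≤ |K| + ‖c‖ * Real.log (max X 2) ^ j := by
      refine (norm_sub_le _ _).trans (add_le_add ((hK x hx hxX.le).trans (le_abs_self K)) ?_)
      rw [norm_mul, norm_ofReal_log_pow hx]
      gcongr
    have h2 : |K| + ‖c‖ * Real.log (max X 2) ^ j ≤
        (|K| + ‖c‖ * Real.log (max X 2) ^ j) * max X 2 / x := by
      rw [le_div_iff₀ hx0]
      gcongr
    have h3 : 0 ≤ ε * (1 + Real.log x) ^ j := by positivity
    linarith

lemma LogAsymptotic.exists_norm_le {F : ℝ → ℂ} {j : ℕ} {c : ℂ} (h : LogAsymptotic F j c) :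
    ∃ C : ℝ, 0 ≤ C ∧ ∀ x, 1 ≤ x → ‖F x‖ ≤ C * (1 + Real.log x) ^ j := by
  obtain ⟨K, hK0, hK⟩ := h.exists_norm_sub_le one_pos
  refine ⟨1 + K + ‖c‖, by positivity, fun x hx => ?_⟩
  have hL := Real.log_nonneg hx
  have h1 := hK x hx
  have h2 : ‖F x‖ ≤ ‖F x - c * (Real.log x : ℂ) ^ j‖ + ‖c * (Real.log x : ℂ) ^ j‖ := by
    simpa using norm_add_le (F x - c * (Real.log x : ℂ) ^ j) (c * (Real.log x : ℂ) ^ j)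
  rw [norm_mul, norm_ofReal_log_pow hx] at h2
  have h3 : ‖c‖ * Real.log x ^ j ≤ ‖c‖ * (1 + Real.log x) ^ j := by
    gcongr
    linarith
  have h4 : K / x ≤ K * (1 + Real.log x) ^ j :=
    (div_le_self hK0 hx).trans (le_mul_of_one_le_right hK0 (one_le_pow₀ (by linarith)))
  linarith

lemma logAsymptotic_of_norm_sub_le {F : ℝ → ℂ} {j : ℕ} {c : ℂ}
    (h : ∀ ε : ℝ, 0 < ε → ∃ K : ℝ, 0 ≤ K ∧ ∀ x, 1 ≤ x → ‖F x - c * (Real.log x : ℂ) ^ (j + 1)‖ ≤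
      ε * (1 + Real.log x) ^ (j + 1) + K * (1 + Real.log x) ^ j) :
    LogAsymptotic F (j + 1) c := by
  constructor
  · intro X
    obtain ⟨K, hK0, hK⟩ := h 1 one_pos
    refine ⟨1 * (1 + Real.log X) ^ (j + 1) + K * (1 + Real.log X) ^ j +
      ‖c‖ * Real.log X ^ (j + 1), fun x hx hxX => ?_⟩
    have hL := Real.log_nonneg hx
    have hLX : Real.log x ≤ Real.log X := Real.log_le_log (by linarith) hxX
    have h2 : ‖F x‖ ≤ ‖F x - c * (Real.log x : ℂ) ^ (j + 1)‖ + ‖c * (Real.log x : ℂ) ^ (j + 1)‖ := by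
      simpa using norm_add_le (F x - c * (Real.log x : ℂ) ^ (j + 1)) (c * (Real.log x : ℂ) ^ (j + 1))
    rw [norm_mul, norm_ofReal_log_pow hx] at h2
    refine h2.trans (add_le_add ((hK x hx).trans ?_) ?_) <;> gcongr
  · rw [Metric.tendsto_nhds]
    intro ε hε
    -- Once `log x ≥ 1`, `1 + log x ≤ 2 log x`; the power of `2` absorbs this, and half of `ε` is
    -- reserved for the lower-order term.
    set η : ℝ := ε / 2 / 2 ^ (j + 1) with hη
    obtain ⟨K, hK0, hK⟩ := h η (by positivity)
    filter_upwards [Real.tendsto_log_atTop.eventually_ge_atTop 1, eventually_ge_atTop (1 : ℝ),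
      Real.tendsto_log_atTop.eventually_gt_atTop (K * 2 ^ j * 2 / ε)] with x hL1 hx hLK
    have hL0 : 0 < Real.log x := by linarith
    have hLj : (Real.log x : ℂ) ^ (j + 1) ≠ 0 :=
      pow_ne_zero _ (Complex.ofReal_ne_zero.2 hL0.ne')
    have e : F x / (Real.log x : ℂ) ^ (j + 1) - c =
        (F x - c * (Real.log x : ℂ) ^ (j + 1)) / (Real.log x : ℂ) ^ (j + 1) := by
      rw [sub_div, mul_div_cancel_right₀ _ hLj]
    rw [dist_eq_norm, e, norm_div, norm_ofReal_log_pow hx, div_lt_iff₀ (by positivity)]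
    refine (hK x hx).trans_lt ?_
    have h2 : 1 + Real.log x ≤ 2 * Real.log x := by linarith
    have h3 : η * (1 + Real.log x) ^ (j + 1) ≤ ε / 2 * Real.log x ^ (j + 1) := by
      calc η * (1 + Real.log x) ^ (j + 1) ≤ η * (2 * Real.log x) ^ (j + 1) := by gcongr
        _ = ε / 2 * Real.log x ^ (j + 1) := by rw [hη, mul_pow]; field_simp
    have h4 : K * (1 + Real.log x) ^ j < ε / 2 * Real.log x ^ (j + 1) := by
      calc K * (1 + Real.log x) ^ j ≤ K * (2 * Real.log x) ^ j := by gcongr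
        _ = (K * 2 ^ j * 2 / ε) * (ε / 2 * Real.log x ^ j) := by rw [mul_pow]; field_simp
        _ < Real.log x * (ε / 2 * Real.log x ^ j) := by gcongr
        _ = _ := by ring
    linarith

/-- Summation of `F (x / m) / m` raises the power of the logarithm by one. -/
lemma LogAsymptotic.sum_div {F : ℝ → ℂ} {j : ℕ} {c : ℂ} (h : LogAsymptotic F j c) :
    LogAsymptotic (fun x => ∑ m ∈ Finset.Ioc 0 ⌊x⌋₊, 1 / (m : ℂ) * F (x / m)) (j + 1)
      (c / (j + 1)) := by
  refine logAsymptotic_of_norm_sub_le fun ε hε => ?_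
  obtain ⟨K, hK0, hK⟩ := h.exists_norm_sub_le hε
  refine ⟨K + 2 * ‖c‖, by positivity, fun x hx => ?_⟩
  have hL := Real.log_nonneg hx
  have hx0 : 0 < x := by linarith
  -- The error of `F` is summed term by term, while the model `c (log (x/m))^j` is compared with its
  -- integral.
  have e : ∑ m ∈ Finset.Ioc 0 ⌊x⌋₊, 1 / (m : ℂ) * F (x / m) -
      c / (j + 1) * (Real.log x : ℂ) ^ (j + 1) =
      ∑ m ∈ Finset.Ioc 0 ⌊x⌋₊, 1 / (m : ℂ) * (F (x / m) - c * (Real.log (x / m) : ℂ) ^ j) +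
      c * ((∑ m ∈ Finset.Ioc 0 ⌊x⌋₊, 1 / (m : ℝ) * Real.log (x / m) ^ j -
        Real.log x ^ (j + 1) / (j + 1) : ℝ) : ℂ) := by
    push_cast
    simp only [mul_sub, Finset.sum_sub_distrib, Finset.mul_sum]
    rw [Finset.sum_congr rfl fun (m : ℕ) _ =>
      mul_left_comm c (1 / (m : ℂ)) ((Real.log (x / (m : ℝ)) : ℂ) ^ j)]
    ring
  rw [e]
  have h1 : ‖c * ((∑ m ∈ Finset.Ioc 0 ⌊x⌋₊, 1 / (m : ℝ) * Real.log (x / m) ^ j -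
      Real.log x ^ (j + 1) / (j + 1) : ℝ) : ℂ)‖ ≤ ‖c‖ * (2 * (1 + Real.log x) ^ j) := by
    rw [norm_mul, Complex.norm_real, Real.norm_eq_abs]
    exact mul_le_mul_of_nonneg_left (abs_sum_log_div_pow_sub_le hx j) (norm_nonneg _)
  have h2 : ‖∑ m ∈ Finset.Ioc 0 ⌊x⌋₊, 1 / (m : ℂ) * (F (x / m) - c * (Real.log (x / m) : ℂ) ^ j)‖ ≤
      ∑ m ∈ Finset.Ioc 0 ⌊x⌋₊, (ε * (1 + Real.log x) ^ j * (m : ℝ)⁻¹ + K / x) := by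
    refine (norm_sum_le _ _).trans (Finset.sum_le_sum fun m hm => ?_)
    obtain ⟨hm0, hmx⟩ := Finset.mem_Ioc.1 hm
    have hmR : (0 : ℝ) < m := Nat.cast_pos.2 hm0
    have hmx' : (m : ℝ) ≤ x := (Nat.le_floor_iff hx0.le).1 hmx
    have hxm : 1 ≤ x / m := (one_le_div hmR).2 hmx'
    rw [norm_mul, norm_div, norm_one, Complex.norm_natCast]
    have hlog := log_div_nat_le hx hm0
    have hlog0 := log_div_nat_nonneg hm0 hmx'
    calc 1 / (m : ℝ) * ‖F (x / m) - c * (Real.log (x / m) : ℂ) ^ j‖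
        ≤ 1 / (m : ℝ) * (ε * (1 + Real.log (x / m)) ^ j + K / (x / m)) := by
          gcongr
          exact hK _ hxm
      _ ≤ 1 / (m : ℝ) * (ε * (1 + Real.log x) ^ j + K / (x / m)) := by gcongr
      _ = _ := by field_simp
  have h3 : ∑ m ∈ Finset.Ioc 0 ⌊x⌋₊, (ε * (1 + Real.log x) ^ j * (m : ℝ)⁻¹ + K / x) ≤
      ε * (1 + Real.log x) ^ (j + 1) + K * (1 + Real.log x) ^ j := by
    rw [Finset.sum_add_distrib, ← Finset.mul_sum, Finset.sum_const, Nat.card_Ioc, nsmul_eq_mul,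
      tsub_zero]
    -- The harmonic sum supplies exactly the one extra factor `1 + log x` allowed in the `ε` term.
    have h4 : ∑ m ∈ Finset.Ioc 0 ⌊x⌋₊, (m : ℝ)⁻¹ ≤ 1 + Real.log x := by
      have h5 := harmonic_le_one_add_log ⌊x⌋₊
      rw [harmonic_eq_sum_Icc] at h5
      push_cast at h5
      refine le_trans (le_of_eq ?_) (h5.trans ?_)
      · rfl
      · have : (0 : ℝ) < ⌊x⌋₊ := Nat.cast_pos.2 (Nat.floor_pos.2 hx)
        gcongr
        exact Nat.floor_le hx0.le
    have h6 : (⌊x⌋₊ : ℝ) * (K / x) ≤ K * (1 + Real.log x) ^ j := by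
      calc (⌊x⌋₊ : ℝ) * (K / x) ≤ x * (K / x) := by
            gcongr
            exact Nat.floor_le hx0.le
        _ = K := by field_simp
        _ ≤ _ := le_mul_of_one_le_right hK0 (one_le_pow₀ (by linarith))
    calc _ ≤ ε * (1 + Real.log x) ^ j * (1 + Real.log x) + K * (1 + Real.log x) ^ j := by gcongr
      _ = _ := by ring
  calc _ ≤ _ := norm_add_le _ _
    _ ≤ _ := add_le_add (h2.trans h3) h1
    _ = _ := by ring

/-! ### Mean values of the divisor functions -/

/-- The summatory function `∑_{n ≤ x} d_k(n) / x` of the `k`-fold divisor function. -/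
noncomputable def divisorMean (k : ℕ) (x : ℝ) : ℂ :=
  (∑ n ∈ Finset.Ioc 0 ⌊x⌋₊, ((ArithmeticFunction.zeta : ArithmeticFunction ℂ) ^ k) n) / (x : ℂ)

lemma divisorMean_of_lt_one {k : ℕ} {x : ℝ} (hx : x < 1) : divisorMean k x = 0 := by
  simp [divisorMean, Nat.floor_eq_zero.2 hx]

lemma divisorMean_succ (k : ℕ) {x : ℝ} (hx : 0 < x) :
    divisorMean (k + 1) x =
      ∑ m ∈ Finset.Ioc 0 ⌊x⌋₊, 1 / (m : ℂ) * divisorMean k (x / m) := by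
  rw [divisorMean, pow_succ', ArithmeticFunction.sum_Ioc_mul_eq_sum_sum, Finset.sum_div]
  refine Finset.sum_congr rfl fun m hm => ?_
  have hm0 : m ≠ 0 := (Finset.mem_Ioc.1 hm).1.ne'
  have hmC : (m : ℂ) ≠ 0 := Nat.cast_ne_zero.2 hm0
  have hxC : (x : ℂ) ≠ 0 := Complex.ofReal_ne_zero.2 hx.ne'
  rw [divisorMean, Nat.floor_div_natCast]
  simp [ArithmeticFunction.natCoe_apply, hm0]
  field_simp

/-- Since `ζ^(k+1) = ζ * ζ^k`, the next mean is the weighted sum in `LogAsymptotic.sum_div`; the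
divisions by `1, …, j` accumulate to `1/j!`. -/
lemma logAsymptotic_divisorMean (j : ℕ) : LogAsymptotic (divisorMean (j + 1)) j (1 / (j ! : ℂ)) := by
  induction j with
  | zero =>
    have h1 : ∀ x : ℝ, divisorMean (0 + 1) x = ((⌊x⌋₊ / x : ℝ) : ℂ) := by
      intro x
      have := ArithmeticFunction.sum_Ioc_zeta ⌊x⌋₊
      simp only [divisorMean, zero_add, pow_one, ArithmeticFunction.natCoe_apply]
      rw [← Nat.cast_sum, this]
      push_cast
      rfl
    constructor
    · refine fun X => ⟨1, fun x hx _ => ?_⟩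
      rw [h1, Complex.norm_real, Real.norm_of_nonneg (by positivity)]
      exact div_le_one_of_le₀ (Nat.floor_le (by linarith)) (by linarith)
    · simp only [h1]
      have := (Complex.continuous_ofReal.tendsto 1).comp (tendsto_nat_floor_div_atTop (R := ℝ))
      simpa [Function.comp_def] using this
  | succ j ih =>
    have h := ih.sum_div
    have e : 1 / (j ! : ℂ) / (j + 1) = 1 / ((j + 1)! : ℂ) := by
      rw [Nat.factorial_succ]
      push_cast
      rw [div_div, mul_comm]
    rw [e] at h
    constructor
    · intro X
      obtain ⟨K, hK⟩ := h.1 X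
      exact ⟨K, fun x hx hxX => divisorMean_succ (j + 1) (by linarith : 0 < x) ▸ hK x hx hxX⟩
    · refine h.2.congr' ?_
      filter_upwards [eventually_gt_atTop (0 : ℝ)] with x hx
      rw [divisorMean_succ (j + 1) hx]

lemma tendsto_log_div_const_div_log {a : ℝ} (ha : 0 < a) :
    Tendsto (fun x : ℝ => Real.log (x / a) / Real.log x) atTop (𝓝 1) := by
  have h : Tendsto (fun x : ℝ => 1 - Real.log a / Real.log x) atTop (𝓝 (1 - 0)) :=
    tendsto_const_nhds.sub (Real.tendsto_log_atTop.const_div_atTop _)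
  rw [sub_zero] at h
  refine h.congr' ?_
  filter_upwards [eventually_gt_atTop (1 : ℝ)] with x hx
  have := (Real.log_pos hx).ne'
  rw [Real.log_div (by linarith) ha.ne', sub_div, div_self this]

lemma LogAsymptotic.tendsto_div_const {F : ℝ → ℂ} {j : ℕ} {c : ℂ} (h : LogAsymptotic F j c)
    {a : ℝ} (ha : 0 < a) :
    Tendsto (fun x : ℝ => F (x / a) / (Real.log x : ℂ) ^ j) atTop (𝓝 c) := by
  have hdiv : Tendsto (fun x : ℝ => x / a) atTop atTop := tendsto_id.atTop_div_const ha
  have h1 := h.2.comp hdiv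
  have h2 := (((Complex.continuous_ofReal.tendsto 1).comp
    (tendsto_log_div_const_div_log ha)).pow j)
  have h3 := h1.mul h2
  simp only [Complex.ofReal_one, one_pow, mul_one] at h3
  refine h3.congr' ?_
  filter_upwards [hdiv.eventually_gt_atTop 1] with x hx
  have hne : (Real.log (x / a) : ℂ) ^ j ≠ 0 :=
    pow_ne_zero _ (Complex.ofReal_ne_zero.2 (Real.log_pos hx).ne')
  simp only [Function.comp_apply, Complex.ofReal_div, div_pow]
  exact div_mul_div_cancel₀ hne

/-- The bound for dominated convergence, hence uniform in `a` for each large `x`: the mean vanishes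
when `a > x`, and otherwise `log (x/a) ≤ log x`. -/
lemma exists_norm_divisorMean_div_le (j : ℕ) : ∃ C : ℝ, ∀ᶠ x : ℝ in atTop, ∀ a : ℕ, 0 < a →
    ‖divisorMean (j + 1) (x / a) / (Real.log x : ℂ) ^ j‖ ≤ C := by
  obtain ⟨C, hC0, hC⟩ := (logAsymptotic_divisorMean j).exists_norm_le
  refine ⟨C * 2 ^ j, ?_⟩
  filter_upwards [Real.tendsto_log_atTop.eventually_ge_atTop 1, eventually_ge_atTop (1 : ℝ)]
    with x hL hx a ha
  rcases lt_or_ge (x / a) 1 with h | h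
  · rw [divisorMean_of_lt_one h]
    simp only [zero_div, norm_zero]
    positivity
  · rw [norm_div, norm_ofReal_log_pow hx, div_le_iff₀ (by positivity)]
    have h0 := Real.log_nonneg h
    have h1 := log_div_nat_le hx ha
    calc ‖divisorMean (j + 1) (x / a)‖ ≤ C * (1 + Real.log (x / a)) ^ j := hC _ h
      _ ≤ C * (2 * Real.log x) ^ j := by
        gcongr
        linarith
      _ = _ := by rw [mul_pow]; ring

/-! ### The asymptotic formula of part (i) -/

lemma sumUpTo_eq (f : ℕ → ℕ → ℂ) (x y : ℝ) :
    sumUpTo f x y = ∑ n₁ ∈ Finset.Ioc 0 ⌊x⌋₊, ∑ n₂ ∈ Finset.Ioc 0 ⌊y⌋₊, f n₁ n₂ := by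
  have h : ∀ N, Finset.Icc 1 N = Finset.Ioc 0 N := fun N => by
    ext
    simp [Nat.succ_le_iff]
  rw [sumUpTo, h, h]

lemma sumUpTo_convSnd_convFst_zeta_pow (h : ℕ → ℕ → ℂ) (k : ℕ) {x y : ℝ} (hx : 0 < x) (hy : 0 < y) :
    sumUpTo (convSnd ((ArithmeticFunction.zeta : ArithmeticFunction ℂ) ^ k)
      (convFst ((ArithmeticFunction.zeta : ArithmeticFunction ℂ) ^ k) h)) x y =
    x * y * ∑' q : ℕ × ℕ, h q.1 q.2 / (q.1 * q.2) *
      (divisorMean k (x / q.1) * divisorMean k (y / q.2)) := by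
  have hxC : (x : ℂ) ≠ 0 := Complex.ofReal_ne_zero.2 hx.ne'
  have hyC : (y : ℂ) ≠ 0 := Complex.ofReal_ne_zero.2 hy.ne'
  rw [sumUpTo_eq, sum_sum_convFst_convSnd, tsum_eq_sum
    (s := Finset.Ioc 0 ⌊x⌋₊ ×ˢ Finset.Ioc 0 ⌊y⌋₊), Finset.sum_product, Finset.mul_sum]
  · refine Finset.sum_congr rfl fun a ha => ?_
    rw [Finset.mul_sum]
    refine Finset.sum_congr rfl fun b hb => ?_
    have haC : (a : ℂ) ≠ 0 := Nat.cast_ne_zero.2 (Finset.mem_Ioc.1 ha).1.ne'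
    have hbC : (b : ℂ) ≠ 0 := Nat.cast_ne_zero.2 (Finset.mem_Ioc.1 hb).1.ne'
    simp only [divisorMean, Nat.floor_div_natCast, Complex.ofReal_div, Complex.ofReal_natCast]
    field_simp
  -- The infinite series is really finite: beyond `x` or `y` a divisor mean is an empty sum, and a
  -- zero coordinate makes the coefficient a division by zero, that is `0`.
  · rintro ⟨a, b⟩ hab
    simp only [Finset.mem_product, Finset.mem_Ioc, not_and_or, not_lt, not_le,
      Nat.le_zero] at hab
    rcases hab with (rfl | h1) | (rfl | h1)
    · simp
    · have : divisorMean k (x / a) = 0 := by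
        rw [divisorMean, Nat.floor_div_natCast, Nat.div_eq_of_lt h1]
        simp
      simp [this]
    · simp
    · have : divisorMean k (y / b) = 0 := by
        rw [divisorMean, Nat.floor_div_natCast, Nat.div_eq_of_lt h1]
        simp
      simp [this]

lemma tendsto_sumUpTo_convSnd_convFst_zeta_pow {h : ℕ → ℕ → ℂ} (j : ℕ)
    (hs : Summable fun q : ℕ × ℕ => h q.1 q.2 / (q.1 * q.2)) :
    Tendsto (fun z : ℝ × ℝ =>
      sumUpTo (convSnd ((ArithmeticFunction.zeta : ArithmeticFunction ℂ) ^ (j + 1))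
        (convFst ((ArithmeticFunction.zeta : ArithmeticFunction ℂ) ^ (j + 1)) h)) z.1 z.2 /
        ((z.1 * z.2 * (Real.log z.1 * Real.log z.2) ^ j : ℝ) : ℂ)) (atTop ×ˢ atTop)
      (𝓝 (1 / (j ! : ℂ) ^ 2 * ∑' q : ℕ × ℕ, h q.1 q.2 / (q.1 * q.2))) := by
  obtain ⟨C, hC⟩ := exists_norm_divisorMean_div_le j
  have hlim : Tendsto (fun z : ℝ × ℝ => ∑' q : ℕ × ℕ, h q.1 q.2 / (q.1 * q.2) *
      ((divisorMean (j + 1) (z.1 / q.1) / (Real.log z.1 : ℂ) ^ j) *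
        (divisorMean (j + 1) (z.2 / q.2) / (Real.log z.2 : ℂ) ^ j))) (atTop ×ˢ atTop)
      (𝓝 (∑' q : ℕ × ℕ, h q.1 q.2 / (q.1 * q.2) * (1 / (j ! : ℂ) * (1 / (j ! : ℂ))))) := by
    refine tendsto_tsum_of_dominated_convergence
      (bound := fun q : ℕ × ℕ => ‖h q.1 q.2 / (q.1 * q.2)‖ * (C * C)) (hs.norm.mul_right _) ?_ ?_
    · rintro ⟨a, b⟩
      rcases Nat.eq_zero_or_pos a with rfl | ha
      · simp
      rcases Nat.eq_zero_or_pos b with rfl | hb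
      · simp
      exact (((logAsymptotic_divisorMean j).tendsto_div_const (Nat.cast_pos.2 ha)).comp
        tendsto_fst |>.mul (((logAsymptotic_divisorMean j).tendsto_div_const
          (Nat.cast_pos.2 hb)).comp tendsto_snd)).const_mul _
    · filter_upwards [hC.prod_mk hC] with z hz
      rintro ⟨a, b⟩
      rcases Nat.eq_zero_or_pos a with rfl | ha
      · simp
      rcases Nat.eq_zero_or_pos b with rfl | hb
      · simp
      rw [norm_mul, norm_mul]
      have h1 := hz.1 a ha
      have h2 := hz.2 b hb
      gcongr
      exact (norm_nonneg _).trans h1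
  rw [tsum_mul_right, mul_comm, ← sq, one_div_pow] at hlim
  refine hlim.congr' ?_
  filter_upwards [(eventually_gt_atTop (1 : ℝ)).prod_mk (eventually_gt_atTop (1 : ℝ))] with z hz
  have h1 := hz.1
  have h2 := hz.2
  have hxC : (z.1 : ℂ) ≠ 0 := Complex.ofReal_ne_zero.2 (by linarith)
  have hyC : (z.2 : ℂ) ≠ 0 := Complex.ofReal_ne_zero.2 (by linarith)
  rw [sumUpTo_convSnd_convFst_zeta_pow h (j + 1) (by linarith) (by linarith)]
  push_cast
  rw [mul_div_mul_left _ _ (mul_ne_zero hxC hyC), ← tsum_div_const]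
  refine tsum_congr fun q => ?_
  rw [mul_pow]
  ring

lemma zeta_pow_mul_moebius_pow (k : ℕ) : (ArithmeticFunction.zeta : ArithmeticFunction ℂ) ^ k *
    (ArithmeticFunction.moebius : ArithmeticFunction ℂ) ^ k = 1 := by
  rw [← mul_pow, ArithmeticFunction.coe_zeta_mul_coe_moebius, one_pow]

lemma convSnd_convFst_zeta_pow_moebius_pow (f : ℕ → ℕ → ℂ) (k : ℕ) {n₁ n₂ : ℕ} (h1 : n₁ ≠ 0)
    (h2 : n₂ ≠ 0) :
    convSnd ((ArithmeticFunction.zeta : ArithmeticFunction ℂ) ^ k)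
      (convFst ((ArithmeticFunction.zeta : ArithmeticFunction ℂ) ^ k)
        (convFst ((ArithmeticFunction.moebius : ArithmeticFunction ℂ) ^ k)
          (convSnd ((ArithmeticFunction.moebius : ArithmeticFunction ℂ) ^ k) f))) n₁ n₂ =
      f n₁ n₂ := by
  rw [convFst_convFst, zeta_pow_mul_moebius_pow, convSnd, convFst_eq_sum]
  simp only [convFst_one _ _ h1]
  rw [← convFst_eq_sum _ fun a b =>
    convSnd ((ArithmeticFunction.moebius : ArithmeticFunction ℂ) ^ k) f b a]
  change convFst _ (convFst _ _) _ _ = _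
  rw [convFst_convFst, zeta_pow_mul_moebius_pow, convFst_one _ _ h2]

/-- When all leading coefficients vanish, `LocallyNear` is the summability hypothesis of the Euler
product for `h(a, b)/(ab)`. -/
lemma IsMultiplicativeTwo.summable_and_hasProd_localTerm {h : ℕ → ℕ → ℂ}
    (hh : IsMultiplicativeTwo h) (h11 : h 1 1 = 1) (hs : LocallyNear h (leadingCoeff 0 0 0)) :
    Summable (fun q : ℕ × ℕ => h q.1 q.2 / (q.1 * q.2)) ∧
      HasProd (fun p : Nat.Primes => ∑' ν : ℕ × ℕ, localTerm h p ν)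
        (∑' q : ℕ × ℕ, h q.1 q.2 / (q.1 * q.2)) := by
  have e : ∀ (p : Nat.Primes) (ν : ℕ × ℕ), localTerm h p ν =
      h ((p : ℕ) ^ ν.1) ((p : ℕ) ^ ν.2) / ((((p : ℕ) ^ ν.1 : ℕ) : ℂ) * (((p : ℕ) ^ ν.2 : ℕ) : ℂ)) := by
    intro p ν
    rw [localTerm, pow_add]
    push_cast
    rfl
  have hmain := summable_and_hasProd_of_multiplicative
    (H := fun q : ℕ × ℕ => h q.1 q.2 / (q.1 * q.2)) (by simp [h11]) ?_ ?_ ?_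
  · simpa only [e] using hmain
  · intro a b hab
    simp only
    rw [← Nat.cast_mul, hab, Nat.cast_zero, div_zero]
  · intro m₁ m₂ n₁ n₂ h1 h2 h3 h4 hc
    simp only
    rw [hh _ _ _ _ h1 h2 h3 h4 hc, div_mul_div_comm]
    push_cast
    ring
  · refine Summable.congr hs fun q => ?_
    simp [e, leadingCoeff]

lemma LocallyNear.multipliable_and_tendsto {f : ℕ → ℕ → ℂ} {j : ℕ} (hf : IsMultiplicativeTwo f)
    (h11 : f 1 1 = 1) (h : LocallyNear f (leadingCoeff (j + 1 : ℕ) (j + 1 : ℕ) 0)) :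
    (Multipliable fun p : Nat.Primes => eulerFactor f (2 * (j + 1)) p) ∧
      Tendsto
        (fun z : ℝ × ℝ => sumUpTo f z.1 z.2 /
          ((z.1 * z.2 * (Real.log z.1 * Real.log z.2) ^ j : ℝ) : ℂ))
        (atTop ×ˢ atTop)
        (𝓝 (1 / (j ! : ℂ) ^ 2 * ∏' p : Nat.Primes, eulerFactor f (2 * (j + 1)) p)) := by
  have hS := h.convSnd_moebius_pow (j + 1)
  have hF := hS.1.convFst_moebius_pow (j + 1)
  rw [sub_self] at hS hF
  set g := convFst ((ArithmeticFunction.moebius : ArithmeticFunction ℂ) ^ (j + 1))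
    (convSnd ((ArithmeticFunction.moebius : ArithmeticFunction ℂ) ^ (j + 1)) f) with hg
  have hm := isMultiplicative_moebius_pow (j + 1)
  have hg11 : g 1 1 = 1 := by
    simp [hg, convSnd, convFst_eq_sum, h11, hm.map_one]
  have hmain := ((hf.convSnd hm).convFst hm).summable_and_hasProd_localTerm hg11 hF.1
  -- Each variable contributes `(1 - 1/p)^(j+1)`, whence the exponent `2 (j + 1)`.
  have he : (fun p : Nat.Primes => ∑' ν : ℕ × ℕ, localTerm g p ν) =
      fun p : Nat.Primes => eulerFactor f (2 * (j + 1)) p := by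
    ext p
    rw [hF.2, hS.2, eulerFactor, ← mul_assoc, ← pow_add, two_mul]
  have hprod := hmain.2
  rw [he] at hprod
  refine ⟨hprod.multipliable, ?_⟩
  rw [hprod.tprod_eq]
  refine (tendsto_sumUpTo_convSnd_convFst_zeta_pow j hmain.1).congr fun z => ?_
  congr 1
  rw [sumUpTo_eq, sumUpTo_eq]
  refine Finset.sum_congr rfl fun a ha => Finset.sum_congr rfl fun b hb => ?_
  exact convSnd_convFst_zeta_pow_moebius_pow f (j + 1) (Finset.mem_Ioc.1 ha).1.ne'
    (Finset.mem_Ioc.1 hb).1.ne'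

/-! ### The diagonal case of part (ii) -/

lemma exists_norm_le_of_floor (F : ℕ → ℂ) (X : ℝ) :
    ∃ K : ℝ, ∀ x : ℝ, x ≤ X → ‖F ⌊x⌋₊‖ ≤ K :=
  ⟨∑ n ∈ Finset.range (⌊X⌋₊ + 1), ‖F n‖, fun _ hx =>
    Finset.single_le_sum (f := fun n => ‖F n‖) (fun _ _ => norm_nonneg _)
      (Finset.mem_range.2 (Nat.lt_succ_of_le (Nat.floor_mono hx)))⟩

/-- The weight `m` against `1/x² = 1/(m² (x/m)²)` leaves `1/m`, which is the form required by
`LogAsymptotic.sum_div`. -/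
lemma sumUpTo_convDiag_idFun (f : ℕ → ℕ → ℂ) {x : ℝ} (hx : 0 < x) :
    sumUpTo (convDiag idFun f) x x / (x : ℂ) ^ 2 = ∑ m ∈ Finset.Ioc 0 ⌊x⌋₊,
      1 / (m : ℂ) * (sumUpTo f (x / m) (x / m) / ((x / m : ℝ) : ℂ) ^ 2) := by
  have hxC : (x : ℂ) ≠ 0 := Complex.ofReal_ne_zero.2 hx.ne'
  rw [sumUpTo_eq, sum_sum_convDiag, Finset.sum_div]
  refine Finset.sum_congr rfl fun m hm => ?_
  have hmC : (m : ℂ) ≠ 0 := Nat.cast_ne_zero.2 (Finset.mem_Ioc.1 hm).1.ne'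
  rw [sumUpTo_eq, Nat.floor_div_natCast]
  push_cast
  simp only [idFun, ArithmeticFunction.coe_mk]
  field_simp

lemma tendsto_sumUpTo_of_convDiag {f : ℕ → ℕ → ℂ} {j : ℕ} {c : ℂ}
    (h : Tendsto (fun z : ℝ × ℝ => sumUpTo f z.1 z.2 /
      ((z.1 * z.2 * (Real.log z.1 * Real.log z.2) ^ j : ℝ) : ℂ)) (atTop ×ˢ atTop) (𝓝 c)) :
    Tendsto (fun x : ℝ => sumUpTo (convDiag idFun f) x x /
      ((x ^ 2 * Real.log x ^ (2 * j + 1) : ℝ) : ℂ)) atTop (𝓝 (c / (2 * j + 1))) := by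
  have hlog : LogAsymptotic (fun x => sumUpTo f x x / (x : ℂ) ^ 2) (2 * j) c := by
    constructor
    · intro X
      obtain ⟨K, hK⟩ := exists_norm_le_of_floor
        (fun N => ∑ n₁ ∈ Finset.Ioc 0 N, ∑ n₂ ∈ Finset.Ioc 0 N, f n₁ n₂) X
      refine ⟨K, fun x hx hxX => ?_⟩
      rw [norm_div, norm_pow, Complex.norm_real, Real.norm_of_nonneg (by linarith), sumUpTo_eq]
      exact (div_le_self (norm_nonneg _) (one_le_pow₀ hx)).trans (hK x hxX)
    -- The two-variable limit is restricted to `x = y`, where the two powers of the logarithm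
    -- combine to `(log x)^(2j)`.
    · refine (h.comp (tendsto_id.prodMk tendsto_id)).congr fun x => ?_
      simp only [Function.comp_apply, id_eq]
      push_cast
      rw [div_div, ← sq, ← sq, ← pow_mul]
  have h2 := hlog.sum_div.2
  push_cast at h2
  refine h2.congr' ?_
  filter_upwards [eventually_gt_atTop (0 : ℝ)] with x hx
  have := sumUpTo_convDiag_idFun f hx
  push_cast at this ⊢
  rw [← this, div_div]

theorem theorem4 (f : ℕ → ℕ → ℂ) (hf : IsMultiplicativeTwo f) (k : ℕ) (hk : 1 ≤ k) :
    (ConditionOne f k →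
      (∀ p : Nat.Primes, Summable fun ν : ℕ × ℕ => localTerm f p ν) ∧
      (Multipliable fun p : Nat.Primes => eulerFactor f (2 * k) p) ∧
      Tendsto
        (fun z : ℝ × ℝ => sumUpTo f z.1 z.2 /
          ((z.1 * z.2 * (Real.log z.1 * Real.log z.2) ^ (k - 1) : ℝ) : ℂ))
        (atTop ×ˢ atTop)
        (𝓝 (1 / ((k - 1)! : ℂ) ^ 2 * ∏' p : Nat.Primes, eulerFactor f (2 * k) p))) ∧
    (ConditionTwo f k →
      (∀ p : Nat.Primes, Summable fun ν : ℕ × ℕ => localTerm f p ν) ∧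
      (Multipliable fun p : Nat.Primes => eulerFactor f (2 * k + 1) p) ∧
      Tendsto
        (fun x : ℝ => sumUpTo f x x /
          ((x ^ 2 * Real.log x ^ (2 * k - 1) : ℝ) : ℂ))
        atTop
        (𝓝 (1 / (((k - 1)! : ℂ) ^ 2 * (2 * (k : ℂ) - 1)) *
          ∏' p : Nat.Primes, eulerFactor f (2 * k + 1) p))) := by
  obtain ⟨j, rfl⟩ := Nat.exists_eq_add_of_le' hk
  rw [Nat.add_sub_cancel]
  constructor
  · intro h
    obtain ⟨h11, hn⟩ := h.locallyNear hf hk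
    exact ⟨hn.summable_localTerm (summable_leadingCoeff _ _ _), hn.multipliable_and_tendsto hf h11⟩
  · intro h
    obtain ⟨h11, hn⟩ := h.locallyNear hf hk
    have hsum := hn.summable_localTerm (summable_leadingCoeff _ _ _)
    -- The diagonal twist lowers the coefficient at `(1, 1)` from `1` to `0`, which puts the twisted
    -- function in the situation of part (i).
    have hg := hn.convDiag_idMoebius
    rw [sub_self] at hg
    have hg11 : convDiag idMoebius f 1 1 = 1 := by simp [convDiag, idMoebius, h11]
    have hmain := hg.multipliable_and_tendsto (hf.convDiag idMoebius_isMultiplicative) hg11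
    -- The twist contributes the additional factor `1 - 1/p`, raising the exponent from `2k` to `2k
    -- + 1`.
    have he : (fun p : Nat.Primes => eulerFactor (convDiag idMoebius f) (2 * (j + 1)) p) =
        fun p : Nat.Primes => eulerFactor f (2 * (j + 1) + 1) p := by
      ext p
      rw [eulerFactor, tsum_localTerm_shift (isLocalShift_convDiag f) (hsum p), ← mul_assoc,
        ← pow_succ, eulerFactor]
    rw [he] at hmain
    refine ⟨hsum, hmain.1, ?_⟩
    have ht := tendsto_sumUpTo_of_convDiag hmain.2
    have hc : 1 / (j ! : ℂ) ^ 2 * (∏' p : Nat.Primes, eulerFactor f (2 * (j + 1) + 1) p) /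
        (2 * j + 1) = 1 / ((j ! : ℂ) ^ 2 * (2 * ((j + 1 : ℕ) : ℂ) - 1)) *
          ∏' p : Nat.Primes, eulerFactor f (2 * (j + 1) + 1) p := by
      have : 2 * ((j + 1 : ℕ) : ℂ) - 1 = 2 * j + 1 := by push_cast; ring
      rw [this, mul_comm (1 / _), mul_comm (1 / _), mul_div_assoc, div_div]
    rw [hc] at ht
    refine ht.congr fun x => ?_
    have hS : sumUpTo (convDiag idFun (convDiag idMoebius f)) x x = sumUpTo f x x := by
      rw [sumUpTo_eq, sumUpTo_eq]
      refine Finset.sum_congr rfl fun a ha => Finset.sum_congr rfl fun b hb => ?_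
      exact convDiag_idFun_idMoebius f (Finset.mem_Ioc.1 ha).1.ne' (Finset.mem_Ioc.1 hb).1.ne'
    rw [hS, show 2 * (j + 1) - 1 = 2 * j + 1 by omega]
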